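/- Let $n,s\ge 0$, $d=n+s$ and $T>0$. Let $\sigma:[0,T]\times\mathbb R^{d}\to\mathbb R^{d\times d}$ take invertible values, let $\mu:[0,T]\times\mathbb R^{d}\to\mathbb R^{d}$, and let $y:[0,T]\to\mathbb R^s$ be $C^1$. For $t\in[0,T]$ and $x,p\in\mathbb R^n$ put $$\psi(t,x,p)=\tfrac12\Bigl|\sigma(t,z)^{-1}\Bigl(\begin{pmatrix}p\\ \dot y_t\end{pmatrix}-\mu(t,z)\Bigr)\Bigr|^2,\qquad z=\begin{pmatrix}x\\ y_t\end{pmatrix},$$ and assume that $\psi$ is twice continuously differentiable in $(x,p)$, with $\psi$ and its first and second derivatives in $(x,p)$ continuous on $[0,T]\times\mathbb R^n\times\mathbb R^n$ (this holds, for instance, if $\sigma$ and $\mu$ are $C^2$). For $\varphi:\mathbb R^n\to\mathbb R$ and a $C^1$ path $x:[0,T]\to\mathbb R^n$ let $$\Lambda(x|y)=-\int_0^T\psi(t,x_t,\dot x_t)\,dt-\varphi(x_0).$$ Let the $C^1$ path $x^*$ be a local minimizer of the action $-\Lambda(\cdot|y)$: there is $\varepsilon>0$ such that $-\Lambda(x^*|y)\le-\Lambda(x|y)$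 for every $C^1$ path $x$ with $|x_t-x^*_t|<\varepsilon$ and $|\dot x_t-\dot x^*_t|<\varepsilon$ for all $t\in[0,T]$. Assume that $\varphi$ is $C^2$ near $x^*_0$. Define $n\times n$ matrices, for $t\in[0,T]$, by $$A^{ij}_t=D_{x_i}D_{x_j}\psi,\qquad B^{ij}_t=D_{x_i}D_{p_j}\psi,\qquad q^{ij}_t=D_{p_i}D_{p_j}\psi,$$ all evaluated at $(t,x^*_t,\dot x^*_t)$. Then $q_t$ is invertible for every $t\in[0,T]$, and: (i) the matrix ODE $$A_t+\dot\theta_t=(B_t+\theta_t)\,q_t^{-1}(B_t^T+\theta_t)\quad(0\le t\le T),\qquad \theta_T=0,$$ has exactly one solution $\theta:[0,T]\to\mathbb R^{n\times n}$; with $K_t=q_t^{-1}(B_t^T+\theta_t)$, its right-hand side equals $K_t^Tq_tK_t$; (ii) with this $\theta$ and $K$, and $$Q_0(\xi)=\tfrac12\,\xi_0\cdot\bigl(D^2\varphi(x^*_0)+\theta_0\bigr)\xi_0+\int_0^T\tfrac12(\dot\xi_t+K_t\xi_t)\cdot q_t(\dot\xi_t+K_t\xi_t)\,dt,$$ one has,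 for $C^1$ paths $\xi:[0,T]\to\mathbb R^n$, $$-\Lambda(x^*+\xi|y)+\Lambda(x^*|y)=Q_0(\xi)+o\Bigl(\int_0^T(|\xi_t|^2+|\dot\xi_t|^2)\,dt\Bigr),$$ that is, for every $\varepsilon>0$ there is $\delta>0$ such that, for every $C^1$ path $\xi$ with $\int_0^T(|\xi_t|^2+|\dot\xi_t|^2)\,dt<\delta$, the two sides without the $o$-term differ by at most $\varepsilon\int_0^T(|\xi_t|^2+|\dot\xi_t|^2)\,dt$. -/

import Mathlib

open Set MeasureTheory
open scoped Matrix

noncomputable section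

namespace LeastAction

/-- `ℝⁿ` with its Euclidean norm. -/
abbrev Vec (n : ℕ) : Type := EuclideanSpace ℝ (Fin n)

/-- The state space `ℝᵈ`, `d = n + s`, of the partitioned process `Z = [X; Y]`. -/
abbrev State (n s : ℕ) : Type := EuclideanSpace ℝ (Fin n ⊕ Fin s)

/-- `d × d` matrices, `d = n + s`. -/
abbrev StateMat (n s : ℕ) : Type := Matrix (Fin n ⊕ Fin s) (Fin n ⊕ Fin s) ℝ

/-- The stacked vector `[x; y]`. -/
def stack {n s : ℕ} (x : Vec n) (y : Vec s) : State n s :=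
  WithLp.toLp 2 (Sum.elim x.ofLp y.ofLp)

/-- `x` is a `C¹` path on `[0,T]`. -/
def IsC1Path {n : ℕ} (T : ℝ) (x : ℝ → Vec n) : Prop :=
  ContDiffOn ℝ 1 x (Icc 0 T)

/-- The derivative of a path on `[0,T]` (one-sided at the end points). -/
def vel {n : ℕ} (T : ℝ) (x : ℝ → Vec n) (t : ℝ) : Vec n :=
  derivWithin x (Icc 0 T) t

/-- The Lagrangian `ψ(t,x,p) = ½ |σ(t,z)⁻¹ (ż - μ(t,z))|²` with `z = [x; y_t]`, `ż = [p; ẏ_t]`. -/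
def psi {n s : ℕ} (T : ℝ) (σ : ℝ → State n s → StateMat n s) (μ : ℝ → State n s → State n s)
    (y : ℝ → Vec s) (t : ℝ) (x p : Vec n) : ℝ :=
  (1 / 2) * ‖WithLp.toLp 2 ((σ t (stack x (y t)))⁻¹ *ᵥ
    (stack p (vel T y t) - μ t (stack x (y t))).ofLp)‖ ^ 2

/-- The functional `Λ(x|y) = - ∫₀ᵀ ψ(t, x_t, ẋ_t) dt - φ(x_0)` of a `C¹` path `x`. The action is
`-Λ(x|y)`. -/
def Lam {n s : ℕ} (T : ℝ) (σ : ℝ → State n s → StateMat n s) (μ : ℝ → State n s → State n s)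
    (y : ℝ → Vec s) (φ : Vec n → ℝ) (x : ℝ → Vec n) : ℝ :=
  -(∫ t in (0 : ℝ)..T, psi T σ μ y t (x t) (vel T x t)) - φ (x 0)

/-- `ψ(t,x,p)` is twice continuously differentiable in `(x,p)`, and `ψ` together with its first and
second derivatives in `(x,p)` is continuous in `(t,x,p)` for `t ∈ [0,T]`. -/
structure IsC2InSpace {n : ℕ} (T : ℝ) (ψ : ℝ → Vec n → Vec n → ℝ) : Prop where
  contDiff : ∀ t ∈ Icc 0 T, ContDiff ℝ 2 (fun v : Vec n × Vec n => ψ t v.1 v.2)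
  continuousOn : ContinuousOn
    (fun w : ℝ × (Vec n × Vec n) => ψ w.1 w.2.1 w.2.2) (Icc 0 T ×ˢ univ)
  continuousOn_fderiv : ContinuousOn
    (fun w : ℝ × (Vec n × Vec n) =>
      fderiv ℝ (fun v : Vec n × Vec n => ψ w.1 v.1 v.2) w.2) (Icc 0 T ×ˢ univ)
  continuousOn_fderiv_fderiv : ContinuousOn
    (fun w : ℝ × (Vec n × Vec n) =>
      fderiv ℝ (fderiv ℝ (fun v : Vec n × Vec n => ψ w.1 v.1 v.2)) w.2) (Icc 0 T ×ˢ univ)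

/-- `x` is a local minimizer of the functional `J` over `C¹` paths, with respect to the `C¹` norm.
(A local minimizer for the uniform or the `H¹` norm is a fortiori one in this sense.) -/
def IsLocalMinimizer {n : ℕ} (T : ℝ) (J : (ℝ → Vec n) → ℝ) (x : ℝ → Vec n) : Prop :=
  IsC1Path T x ∧ ∃ ε > 0, ∀ x' : ℝ → Vec n, IsC1Path T x' →
    (∀ t ∈ Icc 0 T, ‖x' t - x t‖ < ε ∧ ‖vel T x' t - vel T x t‖ < ε) → J x ≤ J x'

/-- The partial derivative `∂f/∂v_i` at `v`. -/
def pd {n : ℕ} (i : Fin n) (f : Vec n → ℝ) (v : Vec n) : ℝ :=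
  fderiv ℝ f v (EuclideanSpace.single i 1)

/-- `A^{ij} = D_{x_i} D_{x_j} ψ` along the path `x`. -/
def matA {n : ℕ} (T : ℝ) (ψ : ℝ → Vec n → Vec n → ℝ) (x : ℝ → Vec n) (t : ℝ) :
    Matrix (Fin n) (Fin n) ℝ :=
  Matrix.of fun i j => pd i (fun a => pd j (fun b => ψ t b (vel T x t)) a) (x t)

/-- `B^{ij} = D_{x_i} D_{p_j} ψ` along the path `x`. -/
def matB {n : ℕ} (T : ℝ) (ψ : ℝ → Vec n → Vec n → ℝ) (x : ℝ → Vec n) (t : ℝ) :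
    Matrix (Fin n) (Fin n) ℝ :=
  Matrix.of fun i j => pd i (fun a => pd j (fun b => ψ t a b) (vel T x t)) (x t)

/-- `q^{ij} = D_{p_i} D_{p_j} ψ` along the path `x`. -/
def matq {n : ℕ} (T : ℝ) (ψ : ℝ → Vec n → Vec n → ℝ) (x : ℝ → Vec n) (t : ℝ) :
    Matrix (Fin n) (Fin n) ℝ :=
  Matrix.of fun i j => pd i (fun a => pd j (fun b => ψ t (x t) b) a) (vel T x t)

/-- The Hessian matrix `D²φ`. -/
def hess {n : ℕ} (φ : Vec n → ℝ) (v : Vec n) : Matrix (Fin n) (Fin n) ℝ :=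
  Matrix.of fun i j => pd i (fun a => pd j φ a) v

/-- `θ` solves `A + θ̇ = (B + θ) q⁻¹ (Bᵀ + θ)` on `[0,T]` with `θ_T = 0`. -/
def IsRiccatiSolution {n : ℕ} (T : ℝ) (A B q θ : ℝ → Matrix (Fin n) (Fin n) ℝ) : Prop :=
  (∀ t ∈ Icc 0 T, ∃ θ' : Matrix (Fin n) (Fin n) ℝ, HasDerivWithinAt θ θ' (Icc 0 T) t ∧
    A t + θ' = (B t + θ t) * (q t)⁻¹ * ((B t)ᵀ + θ t)) ∧ θ T = 0

/-- `K = q⁻¹ (Bᵀ + θ)`. -/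
def matK {n : ℕ} (B q θ : ℝ → Matrix (Fin n) (Fin n) ℝ) (t : ℝ) : Matrix (Fin n) (Fin n) ℝ :=
  (q t)⁻¹ * ((B t)ᵀ + θ t)

/-- `½ ξ_0 · (H + θ_0) ξ_0 + ∫₀ᵀ ½ (ξ̇ + K ξ) · q (ξ̇ + K ξ) dt`. -/
def Q₀ {n : ℕ} (T : ℝ) (H : Matrix (Fin n) (Fin n) ℝ) (q θ K : ℝ → Matrix (Fin n) (Fin n) ℝ)
    (ξ : ℝ → Vec n) : ℝ :=
  (1 / 2) * ((ξ 0).ofLp ⬝ᵥ ((H + θ 0) *ᵥ (ξ 0).ofLp)) +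
    ∫ t in (0 : ℝ)..T, (1 / 2) * (((vel T ξ t).ofLp + K t *ᵥ (ξ t).ofLp) ⬝ᵥ
      (q t *ᵥ ((vel T ξ t).ofLp + K t *ᵥ (ξ t).ofLp)))

/-- `∫₀ᵀ (|ξ|² + |ξ̇|²) dt`. -/
def energy {n : ℕ} (T : ℝ) (ξ : ℝ → Vec n) : ℝ :=
  ∫ t in (0 : ℝ)..T, (‖ξ t‖ ^ 2 + ‖vel T ξ t‖ ^ 2)

end LeastAction

end

/-! The Lagrangian is a quadratic polynomial in the velocity, with leading form ½|σ⁻¹(η,0)|². This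
has two consequences. The leading form is positive definite, so `q` is invertible. And the Taylor
remainder of `ψ` along the path is small relative to |ξ|²+|η|² as soon as ξ is small, whatever η is
(`IsC2InSpace.exists_remainder_le`). Small energy forces ξ to be uniformly small
(`IsC1Path.norm_sq_le_energy`), so the action has a second order expansion with error o(energy)
(`exists_action_expansion`). Scaling a fixed direction, minimality makes the first variation vanish
and the second nonnegative (`IsLocalMinimizer.variation`).

It remains to write half the second variation as `Q₀`. If θ solves the Riccati equation, adding the
derivative of ξ·θξ to the integrand completes the square (`integral_varForm_eq`). The real issue is
that θ might blow up before time 0 is reached. In `exists_riccati_solution` the quadratic term is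
therefore multiplied by a cutoff g of θ, which makes the solution global. Completing the square now
leaves a deficit (1-g) Kξ·qKξ, and the feedback ξ̇ = -cKξ with (1-c)² = 1-g makes the whole
integrand vanish. Nonnegativity of the second variation on this path says that D²φ + θ_0 ≥ 0. Since
θ_t + at is increasing when a bounds the norm of A, this and θ_T = 0 bound θ on both sides,
independently of the cutoff radius. With a larger radius the cutoff is never active. Uniqueness
holds because the equation is locally Lipschitz. -/

noncomputable section

namespace LeastAction

/-! ### Ordinary differential equations with a cut-off nonlinearity -/

section ODE

variable {X : Type*} [NormedAddCommGroup X]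

/-- A family of maps is Lipschitz on bounded sets, uniformly in `t ∈ [0,T]`. -/
def LocLipschitz (T : ℝ) (F : ℝ → X → X) : Prop :=
  ∀ r : ℝ, ∃ K : ℝ, 0 ≤ K ∧ ∀ t ∈ Icc 0 T, ∀ x y : X, ‖x‖ ≤ r → ‖y‖ ≤ r →
    ‖F t x - F t y‖ ≤ K * ‖x - y‖

/-- A Lipschitz cutoff, equal to `1` for `‖x‖ ≤ R` and to `0` for `‖x‖ ≥ 2 R`. -/
def cutoff (R : ℝ) (x : X) : ℝ := max 0 (min 1 (2 - ‖x‖ / R))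

lemma cutoff_nonneg (R : ℝ) (x : X) : 0 ≤ cutoff R x := le_max_left _ _

lemma cutoff_le_one (R : ℝ) (x : X) : cutoff R x ≤ 1 :=
  max_le zero_le_one (min_le_left _ _)

lemma cutoff_eq_one {R : ℝ} (hR : 0 < R) {x : X} (hx : ‖x‖ ≤ R) : cutoff R x = 1 := by
  have : ‖x‖ / R ≤ 1 := (div_le_one hR).2 hx
  rw [cutoff, min_eq_left (by linarith), max_eq_right zero_le_one]

lemma cutoff_eq_zero {R : ℝ} (hR : 0 < R) {x : X} (hx : 2 * R ≤ ‖x‖) : cutoff R x = 0 := by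
  have : 2 ≤ ‖x‖ / R := (le_div_iff₀ hR).2 hx
  rw [cutoff, max_eq_left ((min_le_right _ _).trans (by linarith))]

lemma continuous_cutoff (R : ℝ) : Continuous (cutoff R : X → ℝ) := by
  unfold cutoff; fun_prop

lemma abs_cutoff_sub_le {R : ℝ} (hR : 0 < R) (x y : X) :
    |cutoff R x - cutoff R y| ≤ R⁻¹ * ‖x - y‖ := by
  have h1 : |cutoff R x - cutoff R y| ≤ |(2 - ‖x‖ / R) - (2 - ‖y‖ / R)| := by
    unfold cutoff
    refine (abs_max_sub_max_le_max _ _ _ _).trans ?_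
    have := abs_min_sub_min_le_max 1 (2 - ‖x‖ / R) 1 (2 - ‖y‖ / R)
    simpa using this
  refine h1.trans ?_
  have h2 : (2 - ‖x‖ / R) - (2 - ‖y‖ / R) = R⁻¹ * (‖y‖ - ‖x‖) := by field_simp; ring
  rw [h2, abs_mul, abs_of_pos (inv_pos.2 hR), norm_sub_rev]
  exact mul_le_mul_of_nonneg_left (abs_norm_sub_norm_le _ _) (inv_pos.2 hR).le

lemma LocLipschitz.bounded {T : ℝ} {P : ℝ → X → X} (hP : LocLipschitz T P)
    (hc : ∀ x, ContinuousOn (fun t => P t x) (Icc 0 T)) (r : ℝ) :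
    ∃ C : ℝ, 0 ≤ C ∧ ∀ t ∈ Icc 0 T, ∀ x : X, ‖x‖ ≤ r → ‖P t x‖ ≤ C := by
  obtain ⟨C₀, hC₀⟩ := isCompact_Icc.exists_bound_of_continuousOn (hc 0)
  obtain ⟨K, hK, hK'⟩ := hP (max r 0)
  refine ⟨|C₀| + K * max r 0, by positivity, fun t ht x hx => ?_⟩
  have h1 := hK' t ht x 0 (hx.trans (le_max_left _ _)) (by simp)
  have h2 : ‖P t x‖ ≤ ‖P t 0‖ + ‖P t x - P t 0‖ := by
    simpa using norm_add_le (P t 0) (P t x - P t 0)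
  rw [sub_zero] at h1
  have h3 : K * ‖x‖ ≤ K * max r 0 :=
    mul_le_mul_of_nonneg_left (hx.trans (le_max_left _ _)) hK
  have h4 := (hC₀ t ht).trans (le_abs_self C₀)
  linarith

variable [NormedSpace ℝ X]

/-- A product of bounded Lipschitz functions is Lipschitz, with constant given by the product rule;
`C` bounds `P` on the ball and `R⁻¹` is the Lipschitz constant of the cutoff. -/
lemma LocLipschitz.add_cutoff_smul {T R : ℝ} (hR : 0 < R) {P : ℝ → X → X}
    (hP : LocLipschitz T P) (hc : ∀ x, ContinuousOn (fun t => P t x) (Icc 0 T)) (N : ℝ → X) :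
    LocLipschitz T (fun t x => N t + cutoff R x • P t x) := by
  intro r
  obtain ⟨C, hC, hC'⟩ := hP.bounded hc r
  obtain ⟨K, hK, hK'⟩ := hP r
  refine ⟨K + R⁻¹ * C, by positivity, fun t ht x y hx hy => ?_⟩
  have e : N t + cutoff R x • P t x - (N t + cutoff R y • P t y) =
      cutoff R x • (P t x - P t y) + (cutoff R x - cutoff R y) • P t y := by
    rw [smul_sub, sub_smul]; abel
  rw [e]
  refine (norm_add_le _ _).trans ?_
  rw [norm_smul, norm_smul, Real.norm_eq_abs, Real.norm_eq_abs, abs_of_nonneg (cutoff_nonneg R x)]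
  have h1 : cutoff R x * ‖P t x - P t y‖ ≤ 1 * (K * ‖x - y‖) :=
    mul_le_mul (cutoff_le_one _ _) (hK' t ht x y hx hy) (norm_nonneg _) zero_le_one
  have h2 : |cutoff R x - cutoff R y| * ‖P t y‖ ≤ R⁻¹ * ‖x - y‖ * C :=
    mul_le_mul (abs_cutoff_sub_le hR x y) (hC' t ht y hy) (norm_nonneg _) (by positivity)
  linarith

/-- Global solvability of an ODE whose nonlinear part is cut off. -/
lemma exists_solution_add_cutoff_smul [CompleteSpace X] {T R : ℝ} (hR : 0 < R) {P : ℝ → X → X}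
    (hP : LocLipschitz T P) (hc : ∀ x, ContinuousOn (fun t => P t x) (Icc 0 T)) {N : ℝ → X}
    (hN : ContinuousOn N (Icc 0 T)) {t₀ : ℝ} (ht₀ : t₀ ∈ Icc 0 T) (x₀ : X) :
    ∃ α : ℝ → X, α t₀ = x₀ ∧ ∀ t ∈ Icc 0 T,
      HasDerivWithinAt α (N t + cutoff R (α t) • P t (α t)) (Icc 0 T) t := by
  obtain ⟨C, hC, hC'⟩ := hP.bounded hc (2 * R)
  obtain ⟨C₀, hC₀⟩ := isCompact_Icc.exists_bound_of_continuousOn hN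
  have hT : 0 ≤ T := ht₀.1.trans ht₀.2
  have hbound : ∀ t ∈ Icc 0 T, ∀ x, ‖N t + cutoff R x • P t x‖ ≤ |C₀| + C := by
    intro t ht x
    refine (norm_add_le _ _).trans (add_le_add ((hC₀ t ht).trans (le_abs_self _)) ?_)
    rw [norm_smul, Real.norm_eq_abs, abs_of_nonneg (cutoff_nonneg R x)]
    rcases le_total ‖x‖ (2 * R) with hx | hx
    · have := mul_le_mul (cutoff_le_one R x) (hC' t ht x hx) (norm_nonneg _) zero_le_one
      linarith
    · rw [cutoff_eq_zero hR hx, zero_mul]; exact hC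
  -- `L` bounds the vector field globally, so a solution moves by at most `L * T` and
  -- Picard–Lindelöf applies on the whole interval at once. A Lipschitz constant is needed only on
  -- the ball of that radius.
  set L : NNReal := (|C₀| + C).toNNReal with hL
  set a : NNReal := L * T.toNNReal with ha
  obtain ⟨K, hK, hK'⟩ := (hP.add_cutoff_smul hR hc N) (‖x₀‖ + a)
  have key : IsPicardLindelof (fun t x => N t + cutoff R x • P t x) (⟨t₀, ht₀⟩ : Icc 0 T) x₀ a 0 L
      K.toNNReal := by
    refine ⟨fun t ht => ?_, fun x _ => hN.add ((hc x).const_smul _),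
      fun t ht x _ => (hbound t ht x).trans (Real.le_coe_toNNReal _), ?_⟩
    · have hb : ∀ x ∈ Metric.closedBall x₀ (a : ℝ), ‖x‖ ≤ ‖x₀‖ + a := fun x hx => by
        rw [mem_closedBall_iff_norm] at hx
        have := norm_add_le x₀ (x - x₀)
        rw [add_sub_cancel] at this
        linarith
      refine LipschitzOnWith.of_dist_le_mul fun x hx y hy => ?_
      rw [dist_eq_norm, dist_eq_norm, Real.coe_toNNReal K hK]
      exact hK' t ht x y (hb x hx) (hb y hy)
    · have : max (T - t₀) (t₀ - 0) ≤ T := max_le (by linarith [ht₀.1]) (by linarith [ht₀.2])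
      have h2 := mul_le_mul_of_nonneg_left this L.2
      rw [ha, NNReal.coe_mul, Real.coe_toNNReal T hT, NNReal.coe_zero]
      simpa using h2
  exact key.exists_eq_forall_mem_Icc_hasDerivWithinAt₀

/-- Backward uniqueness for a locally Lipschitz ODE. -/
lemma LocLipschitz.eqOn {T : ℝ} {F : ℝ → X → X} (hF : LocLipschitz T F) {f g : ℝ → X}
    (hf : ∀ t ∈ Icc 0 T, HasDerivWithinAt f (F t (f t)) (Icc 0 T) t)
    (hg : ∀ t ∈ Icc 0 T, HasDerivWithinAt g (F t (g t)) (Icc 0 T) t)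
    (h : f T = g T) : EqOn f g (Icc 0 T) := by
  have hfc : ContinuousOn f (Icc 0 T) := fun t ht => (hf t ht).continuousWithinAt
  have hgc : ContinuousOn g (Icc 0 T) := fun t ht => (hg t ht).continuousWithinAt
  obtain ⟨C, hC⟩ := isCompact_Icc.exists_bound_of_continuousOn hfc
  obtain ⟨D, hD⟩ := isCompact_Icc.exists_bound_of_continuousOn hgc
  obtain ⟨K, hK, hK'⟩ := hF (max C D)
  -- Uniqueness is propagated leftwards from `T`, which calls for derivatives from the left.
  have hd : ∀ {k : ℝ → X} {k' : X} {t : ℝ}, t ∈ Ioc 0 T → HasDerivWithinAt k k' (Icc 0 T) t →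
      HasDerivWithinAt k k' (Iic t) t := fun ht hk =>
    hk.mono_of_mem_nhdsWithin (Filter.mem_of_superset (Icc_mem_nhdsLE ht.1)
      (Icc_subset_Icc_right ht.2))
  refine ODE_solution_unique_of_mem_Icc_left (v := F) (K := K.toNNReal)
    (s := fun _ => {x | ‖x‖ ≤ max C D}) (fun t ht => ?_) hfc
    (fun t ht => hd ht (hf t (Ioc_subset_Icc_self ht)))
    (fun t ht => (hC t (Ioc_subset_Icc_self ht)).trans (le_max_left _ _)) hgc
    (fun t ht => hd ht (hg t (Ioc_subset_Icc_self ht)))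
    (fun t ht => (hD t (Ioc_subset_Icc_self ht)).trans (le_max_right _ _)) h
  refine LipschitzOnWith.of_dist_le_mul fun x hx y hy => ?_
  rw [dist_eq_norm, dist_eq_norm, Real.coe_toNNReal K hK]
  exact hK' t (Ioc_subset_Icc_self ht) x y hx hy

/-- Global solvability of a linear ODE. -/
lemma exists_linear_solution [CompleteSpace X] {T : ℝ} (hT : 0 ≤ T) {M : ℝ → X →L[ℝ] X}
    (hM : ContinuousOn M (Icc 0 T)) (x₀ : X) :
    ∃ α : ℝ → X, α 0 = x₀ ∧ ∀ t ∈ Icc 0 T, HasDerivWithinAt α (M t (α t)) (Icc 0 T) t := by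
  obtain ⟨m, hm⟩ := isCompact_Icc.exists_bound_of_continuousOn hM
  have hm' : ∀ t ∈ Icc 0 T, ∀ x, ‖M t x‖ ≤ |m| * ‖x‖ := fun t ht x =>
    ((M t).le_opNorm x).trans
      (mul_le_mul_of_nonneg_right ((hm t ht).trans (le_abs_self _)) (norm_nonneg _))
  have hP : LocLipschitz T (fun t x => M t x) := fun r =>
    ⟨|m|, abs_nonneg _, fun t ht x y _ _ => by rw [← map_sub]; exact hm' t ht _⟩
  -- This is the Grönwall bound plus one. The cutoff is at most `1`, so the cut-off solution obeys
  -- the same bound and never meets the cutoff.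
  set R := ‖x₀‖ * Real.exp (|m| * T) + 1 with hRdef
  have hR : 0 < R := by positivity
  obtain ⟨α, h0, hα⟩ := exists_solution_add_cutoff_smul hR hP
    (fun x => hM.clm_apply continuousOn_const) (continuousOn_const (c := (0 : X)))
    (left_mem_Icc.2 hT) x₀
  refine ⟨α, h0, fun t ht => ?_⟩
  have hb := norm_le_gronwallBound_of_norm_deriv_right_le (f := α) (δ := ‖x₀‖) (K := |m|) (ε := 0)
    (a := 0) (b := T) (f' := fun t => 0 + cutoff R (α t) • M t (α t))
    (fun t ht => (hα t ht).continuousWithinAt)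
    (fun t ht => (hα t (Ico_subset_Icc_self ht)).mono_of_mem_nhdsWithin
      (Filter.mem_of_superset (Icc_mem_nhdsGE ht.2) (Icc_subset_Icc_left ht.1)))
    (by rw [h0]) (fun t ht => by
      rw [zero_add, norm_smul, Real.norm_eq_abs, abs_of_nonneg (cutoff_nonneg _ _), add_zero]
      have := mul_le_mul (cutoff_le_one R (α t)) (hm' t (Ico_subset_Icc_self ht) (α t))
        (norm_nonneg _) zero_le_one
      linarith) t ht
  rw [gronwallBound_ε0, sub_zero] at hb
  have h2 : ‖x₀‖ * Real.exp (|m| * t) ≤ ‖x₀‖ * Real.exp (|m| * T) :=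
    mul_le_mul_of_nonneg_left (Real.exp_le_exp.2
      (mul_le_mul_of_nonneg_left ht.2 (abs_nonneg _))) (norm_nonneg _)
  have h3 := hα t ht
  rwa [cutoff_eq_one hR (by linarith), one_smul, zero_add] at h3

end ODE

/-! ### The Riccati equation and completing the square -/

section Riccati

variable {E : Type*} [NormedAddCommGroup E] [InnerProductSpace ℝ E]

/-- The integrand `x·Ax + 2 x·Bw + w·qw` of twice the second variation. -/
def varForm (A B q : E →L[ℝ] E) (x w : E) : ℝ :=
  inner ℝ x (A x) + 2 * inner ℝ x (B w) + inner ℝ w (q w)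

lemma continuousOn_varForm {A B q : ℝ → E →L[ℝ] E} {s : Set ℝ} (hA : ContinuousOn A s)
    (hB : ContinuousOn B s) (hq : ContinuousOn q s) {x w : ℝ → E} (hx : ContinuousOn x s)
    (hw : ContinuousOn w s) : ContinuousOn (fun t => varForm (A t) (B t) (q t) (x t) (w t)) s := by
  unfold varForm
  exact ((hx.inner (hA.clm_apply hx)).add
    (continuousOn_const.mul (hx.inner (hB.clm_apply hw)))).add (hw.inner (hq.clm_apply hw))

variable [CompleteSpace E]

/-- The quadratic map `(B + Θ) r (B* + Θ)` of the Riccati equation. -/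
def riccatiQuad (B r Θ : E →L[ℝ] E) : E →L[ℝ] E := (B + Θ) * r * (star B + Θ)

lemma norm_star_clm (B : E →L[ℝ] E) : ‖star B‖ = ‖B‖ :=
  ContinuousLinearMap.adjoint.norm_map B

lemma continuousOn_riccatiQuad {B r Θ : ℝ → E →L[ℝ] E} {s : Set ℝ} (hB : ContinuousOn B s)
    (hr : ContinuousOn r s) (hΘ : ContinuousOn Θ s) :
    ContinuousOn (fun t => riccatiQuad (B t) (r t) (Θ t)) s :=
  ((hB.add hΘ).mul hr).mul (hB.star.add hΘ)

lemma locLipschitz_riccatiQuad {T : ℝ} {B r : ℝ → E →L[ℝ] E} (hB : ContinuousOn B (Icc 0 T))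
    (hr : ContinuousOn r (Icc 0 T)) :
    LocLipschitz T (fun t X => riccatiQuad (B t) (r t) X) := by
  intro R
  obtain ⟨b, hb⟩ := isCompact_Icc.exists_bound_of_continuousOn hB
  obtain ⟨c, hc⟩ := isCompact_Icc.exists_bound_of_continuousOn hr
  refine ⟨2 * (|c| * (|b| + |R|)), by positivity, fun t ht X Y hX hY => ?_⟩
  have e : riccatiQuad (B t) (r t) X - riccatiQuad (B t) (r t) Y =
      (X - Y) * (r t * (star (B t) + X)) + (B t + Y) * r t * (X - Y) := by
    unfold riccatiQuad; noncomm_ring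
  have hb' := (hb t ht).trans (le_abs_self b)
  have hc' := (hc t ht).trans (le_abs_self c)
  have h1 : ‖star (B t) + X‖ ≤ |b| + |R| :=
    (norm_add_le _ _).trans (add_le_add (by rwa [norm_star_clm]) (hX.trans (le_abs_self _)))
  have h2 : ‖B t + Y‖ ≤ |b| + |R| :=
    (norm_add_le _ _).trans (add_le_add hb' (hY.trans (le_abs_self _)))
  have h3 : ‖(X - Y) * (r t * (star (B t) + X))‖ ≤ ‖X - Y‖ * (|c| * (|b| + |R|)) :=
    (norm_mul_le _ _).trans (mul_le_mul_of_nonneg_left ((norm_mul_le _ _).trans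
      (mul_le_mul hc' h1 (norm_nonneg _) (abs_nonneg _))) (norm_nonneg _))
  have h4 : ‖(B t + Y) * r t * (X - Y)‖ ≤ (|b| + |R|) * |c| * ‖X - Y‖ :=
    (norm_mul_le _ _).trans (mul_le_mul_of_nonneg_right ((norm_mul_le _ _).trans
      (mul_le_mul h2 hc' (norm_nonneg _) (by positivity))) (norm_nonneg _))
  rw [e]
  refine (norm_add_le _ _).trans ?_
  linarith

/-- The quadratic term commutes with taking adjoints; combined with uniqueness this makes solutions
self-adjoint. -/
lemma star_riccatiQuad {B r : E →L[ℝ] E} (hr : star r = r) (Θ : E →L[ℝ] E) :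
    star (riccatiQuad B r Θ) = riccatiQuad B r (star Θ) := by
  simp [riccatiQuad, hr, mul_assoc]

lemma inner_star_apply (B : E →L[ℝ] E) (x y : E) : inner ℝ (star B x) y = inner ℝ x (B y) := by
  rw [ContinuousLinearMap.star_eq_adjoint, ContinuousLinearMap.adjoint_inner_left]

/-- For self-adjoint `Θ`, `B + Θ` is the adjoint of `star B + Θ`, and `q * r = 1` turns `star B + Θ`
into `q` applied to the gain. When `q ≥ 0`, the quadratic term is thus nonnegative. -/
lemma inner_riccatiQuad {B q r Θ : E →L[ℝ] E} (hqr : q * r = 1)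
    (hΘ : star Θ = Θ) (x : E) :
    inner ℝ x (riccatiQuad B r Θ x) =
      inner ℝ ((r * (star B + Θ)) x) (q ((r * (star B + Θ)) x)) := by
  have h : q ((r * (star B + Θ)) x) = (star B + Θ) x := by
    rw [← mul_apply_eq_comp, ← mul_assoc, hqr, one_mul]
  have h2 : star B + Θ = star (B + Θ) := by rw [star_add, hΘ]
  rw [h, riccatiQuad, mul_assoc, mul_apply_eq_comp, ← inner_star_apply, ← h2,
    real_inner_comm]

/-- Completing the square. -/
lemma varForm_add_deriv {A B q r Θ : E →L[ℝ] E} (hq : star q = q) (hqr : q * r = 1)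
    (hΘ : star Θ = Θ) (g : ℝ) (x w : E) :
    varForm A B q x w +
      (inner ℝ x ((-A + g • riccatiQuad B r Θ) x + Θ w) + inner ℝ w (Θ x)) =
    inner ℝ (w + (r * (star B + Θ)) x) (q (w + (r * (star B + Θ)) x)) -
      (1 - g) * inner ℝ ((r * (star B + Θ)) x) (q ((r * (star B + Θ)) x)) := by
  have h0 := inner_riccatiQuad hqr hΘ (B := B) x
  have h : q ((r * (star B + Θ)) x) = (star B + Θ) x := by
    rw [← mul_apply_eq_comp, ← mul_assoc, hqr, one_mul]
  set k := (r * (star B + Θ)) x with hk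
  have h1 : inner ℝ w (q k) = inner ℝ x (B w) + inner ℝ w (Θ x) := by
    rw [h, add_apply, inner_add_right, real_inner_comm, inner_star_apply]
  have h2 : inner ℝ k (q w) = inner ℝ w (q k) := by
    rw [← inner_star_apply, hq, real_inner_comm]
  have h3 : inner ℝ x (Θ w) = inner ℝ w (Θ x) := by
    rw [← inner_star_apply, hΘ, real_inner_comm]
  simp only [varForm, map_add, inner_add_left, inner_add_right, add_apply,
    neg_apply, smul_apply, inner_neg_right,
    inner_smul_right, h0, h2, h3] at *
  rw [h1]
  ring

/-- Integrated form of completing the square: the boundary term at `T` vanishes. -/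
lemma integral_varForm_eq {T : ℝ} (hT : 0 ≤ T) {A B q r Θ : ℝ → E →L[ℝ] E}
    (hA : ContinuousOn A (Icc 0 T)) (hB : ContinuousOn B (Icc 0 T))
    (hq : ContinuousOn q (Icc 0 T)) (hr : ContinuousOn r (Icc 0 T))
    (hqs : ∀ t ∈ Icc 0 T, star (q t) = q t) (hqr : ∀ t ∈ Icc 0 T, q t * r t = 1)
    {g : ℝ → ℝ} (hg : ContinuousOn g (Icc 0 T))
    (hΘ : ∀ t ∈ Icc 0 T,
      HasDerivWithinAt Θ (-A t + g t • riccatiQuad (B t) (r t) (Θ t)) (Icc 0 T) t)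
    (hΘs : ∀ t ∈ Icc 0 T, star (Θ t) = Θ t) (hΘT : Θ T = 0) {x w : ℝ → E}
    (hx : ∀ t ∈ Icc 0 T, HasDerivWithinAt x (w t) (Icc 0 T) t) (hw : ContinuousOn w (Icc 0 T)) :
    ∫ t in (0 : ℝ)..T, varForm (A t) (B t) (q t) (x t) (w t) =
      inner ℝ (x 0) (Θ 0 (x 0)) + ∫ t in (0 : ℝ)..T,
        (inner ℝ (w t + (r t * (star (B t) + Θ t)) (x t))
          (q t (w t + (r t * (star (B t) + Θ t)) (x t))) -
        (1 - g t) * inner ℝ ((r t * (star (B t) + Θ t)) (x t))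
          (q t ((r t * (star (B t) + Θ t)) (x t)))) := by
  have hxc : ContinuousOn x (Icc 0 T) := fun t ht => (hx t ht).continuousWithinAt
  have hΘc : ContinuousOn Θ (Icc 0 T) := fun t ht => (hΘ t ht).continuousWithinAt
  have hd : ∀ t ∈ Icc 0 T, HasDerivWithinAt (fun t => inner ℝ (x t) (Θ t (x t)))
      (inner ℝ (x t) ((-A t + g t • riccatiQuad (B t) (r t) (Θ t)) (x t) + Θ t (w t)) +
        inner ℝ (w t) (Θ t (x t))) (Icc 0 T) t := fun t ht =>
    (hx t ht).inner ℝ ((hΘ t ht).clm_apply (hx t ht))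
  have hdc : ContinuousOn (fun t =>
      inner ℝ (x t) ((-A t + g t • riccatiQuad (B t) (r t) (Θ t)) (x t) + Θ t (w t)) +
        inner ℝ (w t) (Θ t (x t))) (Icc 0 T) :=
    (hxc.inner (((hA.neg.add (hg.smul (continuousOn_riccatiQuad hB hr hΘc))).clm_apply hxc).add
      (hΘc.clm_apply hw))).add (hw.inner (hΘc.clm_apply hxc))
  have hdi := hdc.intervalIntegrable_of_Icc (μ := volume) hT
  have ftc := intervalIntegral.integral_eq_sub_of_hasDerivAt_of_le hT
    (fun t ht => (hd t ht).continuousWithinAt)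
    (fun t ht => (hd t (Ioo_subset_Icc_self ht)).hasDerivAt (Icc_mem_nhds ht.1 ht.2)) hdi
  rw [hΘT] at ftc
  simp only [zero_apply, inner_zero_right, zero_sub] at ftc
  have hvi := (continuousOn_varForm hA hB hq hxc hw).intervalIntegrable_of_Icc (μ := volume) hT
  have hsum := intervalIntegral.integral_add hvi hdi
  rw [ftc] at hsum
  have hcongr := intervalIntegral.integral_congr (μ := volume) (a := 0) (b := T)
    (f := fun t => varForm (A t) (B t) (q t) (x t) (w t) +
      (inner ℝ (x t) ((-A t + g t • riccatiQuad (B t) (r t) (Θ t)) (x t) + Θ t (w t)) +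
        inner ℝ (w t) (Θ t (x t))))
    (g := fun t => inner ℝ (w t + (r t * (star (B t) + Θ t)) (x t))
          (q t (w t + (r t * (star (B t) + Θ t)) (x t))) -
        (1 - g t) * inner ℝ ((r t * (star (B t) + Θ t)) (x t))
          (q t ((r t * (star (B t) + Θ t)) (x t))))
    (fun t ht => by
      rw [uIcc_of_le hT] at ht
      exact varForm_add_deriv (hqs t ht) (hqr t ht) (hΘs t ht) (g t) (x t) (w t))
  rw [← hcongr, hsum]
  ring

/-- A bound on the quadratic form of a self-adjoint operator bounds its norm. -/
lemma norm_le_of_abs_inner_le {S : E →L[ℝ] E} (hS : star S = S) {C : ℝ} (hC : 0 ≤ C)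
    (h : ∀ v, |inner ℝ v (S v)| ≤ C * ‖v‖ ^ 2) : ‖S‖ ≤ C := by
  have hsym : (S : E →ₗ[ℝ] E).IsSymmetric := fun x y => by
    change inner ℝ (S x) y = inner ℝ x (S y)
    rw [← inner_star_apply, hS]
  rw [ContinuousLinearMap.norm_eq_iSup_rayleighQuotient S hsym]
  refine ciSup_le fun v => ?_
  rw [ContinuousLinearMap.rayleighQuotient, abs_div, abs_of_nonneg (sq_nonneg ‖v‖)]
  refine div_le_of_le_mul₀ (sq_nonneg _) hC ?_
  have := h v
  rw [ContinuousLinearMap.reApplyInnerSelf_apply, RCLike.re_to_real, real_inner_comm]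
  exact this

/-- If the second variation is nonnegative, the Riccati equation with terminal value `0` is
solvable on all of `[0,T]`. -/
theorem exists_riccati_solution {T : ℝ} (hT : 0 ≤ T) {A B q r : ℝ → E →L[ℝ] E} {H : E →L[ℝ] E}
    (hA : ContinuousOn A (Icc 0 T)) (hB : ContinuousOn B (Icc 0 T))
    (hq : ContinuousOn q (Icc 0 T)) (hr : ContinuousOn r (Icc 0 T))
    (hAs : ∀ t ∈ Icc 0 T, star (A t) = A t) (hqs : ∀ t ∈ Icc 0 T, star (q t) = q t)
    (hrs : ∀ t ∈ Icc 0 T, star (r t) = r t)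
    (hq0 : ∀ t ∈ Icc 0 T, ∀ v, 0 ≤ inner ℝ v (q t v))
    (hqr : ∀ t ∈ Icc 0 T, q t * r t = 1)
    (hS : ∀ x w : ℝ → E, (∀ t ∈ Icc 0 T, HasDerivWithinAt x (w t) (Icc 0 T) t) →
      ContinuousOn w (Icc 0 T) → 0 ≤ inner ℝ (x 0) (H (x 0)) +
        ∫ t in (0 : ℝ)..T, varForm (A t) (B t) (q t) (x t) (w t)) :
    ∃ Θ : ℝ → E →L[ℝ] E, (∀ t ∈ Icc 0 T,
      HasDerivWithinAt Θ (-A t + riccatiQuad (B t) (r t) (Θ t)) (Icc 0 T) t) ∧ Θ T = 0 := by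
  obtain ⟨a₀, ha₀⟩ := isCompact_Icc.exists_bound_of_continuousOn hA
  set a := |a₀| with ha
  have ha' : ∀ t ∈ Icc 0 T, ∀ v, inner ℝ v (A t v) ≤ a * ‖v‖ ^ 2 := fun t ht v => by
    have h1 := real_inner_le_norm v (A t v)
    have h2 := ((A t).le_opNorm v).trans
      (mul_le_mul_of_nonneg_right ((ha₀ t ht).trans (le_abs_self a₀)) (norm_nonneg v))
    have h3 := mul_le_mul_of_nonneg_left h2 (norm_nonneg v)
    calc _ ≤ _ := h1
      _ ≤ _ := h3
      _ = _ := by ring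
  -- The a priori bound proved in `hbound` is `‖H‖ + a * T`, hence strictly below the cutoff radius.
  set R := ‖H‖ + a * T + 1 with hRdef
  have hR : 0 < R := by positivity
  have hP := locLipschitz_riccatiQuad hB hr
  have hPc : ∀ X, ContinuousOn (fun t => riccatiQuad (B t) (r t) X) (Icc 0 T) := fun X =>
    continuousOn_riccatiQuad hB hr continuousOn_const
  obtain ⟨Θ, hΘT, hΘ⟩ := exists_solution_add_cutoff_smul hR hP hPc hA.neg (right_mem_Icc.2 hT)
    (0 : E →L[ℝ] E)
  have hΘc : ContinuousOn Θ (Icc 0 T) := fun t ht => (hΘ t ht).continuousWithinAt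
  -- The cutoff depends on the norm only, so the adjoint solves the same cut-off equation with the
  -- same terminal value.
  have hΘs : ∀ t ∈ Icc 0 T, star (Θ t) = Θ t := by
    refine (hP.add_cutoff_smul hR hPc (fun t => -A t)).eqOn (f := fun t => star (Θ t))
      (fun t ht => ?_) hΘ (by simp [hΘT])
    have h1 := (hΘ t ht).star
    have h2 : cutoff R (star (Θ t)) = cutoff R (Θ t) := by simp [cutoff, norm_star_clm]
    rw [h2, ← star_riccatiQuad (hrs t ht)]
    refine h1.congr_deriv ?_
    simp [hAs t ht]
  set g : ℝ → ℝ := fun t => cutoff R (Θ t) with hg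
  have hgc : ContinuousOn g (Icc 0 T) := (continuous_cutoff R).comp_continuousOn hΘc
  -- The root of `(1 - c)² = 1 - g` that makes the feedback `w = -c K x` cancel the deficit left by
  -- the cutoff.
  set c : ℝ → ℝ := fun t => 1 - Real.sqrt (1 - g t) with hc
  have hcg : ∀ t, (1 - c t) ^ 2 = 1 - g t := fun t => by
    rw [hc]; simp only [sub_sub_cancel]
    exact Real.sq_sqrt (by linarith [cutoff_le_one R (Θ t)])
  have hcc : ContinuousOn c (Icc 0 T) :=
    continuousOn_const.sub (Real.continuous_sqrt.comp_continuousOn (continuousOn_const.sub hgc))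
  set K : ℝ → E →L[ℝ] E := fun t => r t * (star (B t) + Θ t) with hK
  have hKc : ContinuousOn K (Icc 0 T) := hr.mul (hB.star.add hΘc)
  -- Test the second variation on the feedback path started at `v`: its completed integrand is zero,
  -- so only the boundary terms at time `0` survive.
  have hlow0 : ∀ v, 0 ≤ inner ℝ v (H v) + inner ℝ v (Θ 0 v) := by
    intro v
    have hMc : ContinuousOn (fun t => -(c t • K t)) (Icc 0 T) := (hcc.smul hKc).neg
    obtain ⟨x, hx0, hx⟩ := exists_linear_solution hT hMc v
    have hxc : ContinuousOn x (Icc 0 T) := fun t ht => (hx t ht).continuousWithinAt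
    have hwc := hMc.clm_apply hxc
    have h1 := hS x _ hx hwc
    rw [integral_varForm_eq hT hA hB hq hr hqs hqr hgc hΘ hΘs hΘT hx hwc,
      intervalIntegral.integral_congr (g := fun _ => (0 : ℝ)) (fun t _ => ?_),
      intervalIntegral.integral_zero, add_zero, hx0] at h1
    · exact h1
    · have e : (-(c t • K t)) (x t) + (r t * (star (B t) + Θ t)) (x t) =
          (1 - c t) • K t (x t) := by
        simp only [hK, neg_apply, smul_apply, sub_smul,
          one_smul]
        abel
      simp only [e, map_smul, inner_smul_left, inner_smul_right, RCLike.conj_to_real]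
      have := hcg t
      simp only [hK] at *
      rw [← this]
      ring
  -- The cut-off quadratic term has the sign of `g ≥ 0`, and `a` dominates the contribution of `-A`.
  have hmono : ∀ v, MonotoneOn (fun t => inner ℝ v (Θ t v) + a * ‖v‖ ^ 2 * t) (Icc 0 T) := by
    intro v
    have hd : ∀ t ∈ Icc 0 T, HasDerivWithinAt (fun t => inner ℝ v (Θ t v) + a * ‖v‖ ^ 2 * t)
        (inner ℝ v ((-A t + g t • riccatiQuad (B t) (r t) (Θ t)) v) + a * ‖v‖ ^ 2)
        (Icc 0 T) t := by
      intro t ht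
      have h1 := (hasDerivWithinAt_const t (Icc 0 T) v).inner ℝ
        ((hΘ t ht).clm_apply (hasDerivWithinAt_const t (Icc 0 T) v))
      have h2 := (hasDerivWithinAt_id t (Icc 0 T)).const_mul (a * ‖v‖ ^ 2)
      exact (h1.add h2).congr_deriv (by simp [hg])
    refine monotoneOn_of_hasDerivWithinAt_nonneg (convex_Icc 0 T)
      (fun t ht => (hd t ht).continuousWithinAt)
      (fun t ht => (hd t (interior_subset ht)).mono interior_subset) (fun t ht => ?_)
    have ht' := interior_subset ht
    rw [add_apply, inner_add_right, neg_apply,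
      inner_neg_right, smul_apply, inner_smul_right,
      inner_riccatiQuad (hqr t ht') (hΘs t ht')]
    have h1 := ha' t ht' v
    have h2 := mul_nonneg (cutoff_nonneg R (Θ t))
      (hq0 t ht' ((r t * (star (B t) + Θ t)) v))
    linarith
  -- Monotonicity compares time `t` with both ends: `Θ T = 0` gives the upper bound and `hlow0` the
  -- lower one.
  have hbound : ∀ t ∈ Icc 0 T, ‖Θ t‖ ≤ R := by
    intro t ht
    have hC : 0 ≤ ‖H‖ + a * T := by positivity
    refine (norm_le_of_abs_inner_le (hΘs t ht) hC fun v => ?_).trans (by linarith)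
    have h1 := hmono v (left_mem_Icc.2 hT) ht ht.1
    have h2 := hmono v ht (right_mem_Icc.2 hT) ht.2
    have h3 := hlow0 v
    have h4 : inner ℝ v (H v) ≤ ‖H‖ * ‖v‖ ^ 2 := by
      have := mul_le_mul_of_nonneg_left (H.le_opNorm v) (norm_nonneg v)
      have := real_inner_le_norm v (H v)
      nlinarith
    simp only [hΘT, zero_apply, inner_zero_right] at h2
    have hv : 0 ≤ a * ‖v‖ ^ 2 := by positivity
    have h5 := mul_le_mul_of_nonneg_left ht.2 hv
    have h6 := mul_nonneg hv ht.1
    have h7 : 0 ≤ ‖H‖ * ‖v‖ ^ 2 := by positivity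
    rw [abs_le]
    constructor <;> linarith
  refine ⟨Θ, fun t ht => ?_, hΘT⟩
  have := hΘ t ht
  rwa [cutoff_eq_one hR (hbound t ht), one_smul] at this

lemma riccati_unique {T : ℝ} {A B r Θ₁ Θ₂ : ℝ → E →L[ℝ] E}
    (hB : ContinuousOn B (Icc 0 T)) (hr : ContinuousOn r (Icc 0 T))
    (h₁ : ∀ t ∈ Icc 0 T,
      HasDerivWithinAt Θ₁ (-A t + riccatiQuad (B t) (r t) (Θ₁ t)) (Icc 0 T) t)
    (h₂ : ∀ t ∈ Icc 0 T,
      HasDerivWithinAt Θ₂ (-A t + riccatiQuad (B t) (r t) (Θ₂ t)) (Icc 0 T) t)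
    (h : Θ₁ T = Θ₂ T) : EqOn Θ₁ Θ₂ (Icc 0 T) := by
  have hL : LocLipschitz T (fun t X => -A t + riccatiQuad (B t) (r t) X) := fun R => by
    obtain ⟨K, hK, hK'⟩ := locLipschitz_riccatiQuad hB hr R
    exact ⟨K, hK, fun t ht x y hx hy => by simpa using hK' t ht x y hx hy⟩
  exact hL.eqOn h₁ h₂ h

/-- The adjoint of a solution is again a solution with zero terminal value, so uniqueness applies.
-/
lemma riccati_star_eq {T : ℝ} {A B r Θ : ℝ → E →L[ℝ] E}
    (hB : ContinuousOn B (Icc 0 T)) (hr : ContinuousOn r (Icc 0 T))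
    (hAs : ∀ t ∈ Icc 0 T, star (A t) = A t) (hrs : ∀ t ∈ Icc 0 T, star (r t) = r t)
    (hΘ : ∀ t ∈ Icc 0 T,
      HasDerivWithinAt Θ (-A t + riccatiQuad (B t) (r t) (Θ t)) (Icc 0 T) t)
    (hΘT : Θ T = 0) : ∀ t ∈ Icc 0 T, star (Θ t) = Θ t := by
  refine riccati_unique hB hr (Θ₁ := fun t => star (Θ t)) (fun t ht => ?_) hΘ (by simp [hΘT])
  rw [← star_riccatiQuad (hrs t ht)]
  have h := (hΘ t ht).star
  rwa [star_add, star_neg, hAs t ht] at h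

end Riccati

/-! ### Uniform second order Taylor estimates -/

section Taylor

variable {V : Type*} [NormedAddCommGroup V]

/-- Uniform continuity along a path in the space variable. -/
lemma exists_uniform_modulus [ProperSpace V] {W : Type*} [NormedAddCommGroup W] {T : ℝ}
    {G : ℝ × V → W} (hG : ContinuousOn G (Icc 0 T ×ˢ univ)) {z : ℝ → V}
    (hz : ContinuousOn z (Icc 0 T)) {ε : ℝ} (hε : 0 < ε) :
    ∃ δ > 0, ∀ t ∈ Icc 0 T, ∀ w, ‖w‖ ≤ δ → ‖G (t, z t + w) - G (t, z t)‖ ≤ ε := by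
  -- Perturbations are confined to the unit ball to get a compact set; this is why the final radius
  -- is capped by `1`.
  have hK : IsCompact (Icc (0 : ℝ) T ×ˢ Metric.closedBall (0 : V) 1) :=
    isCompact_Icc.prod (isCompact_closedBall _ _)
  have hc : ContinuousOn (fun u : ℝ × V => G (u.1, z u.1 + u.2))
      (Icc (0 : ℝ) T ×ˢ Metric.closedBall (0 : V) 1) := by
    refine hG.comp (continuousOn_fst.prodMk
      ((hz.comp continuousOn_fst fun u hu => hu.1).add continuousOn_snd)) fun u hu => ?_
    exact ⟨hu.1, mem_univ _⟩
  obtain ⟨δ, hδ, h⟩ := Metric.uniformContinuousOn_iff_le.1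
    (hK.uniformContinuousOn_of_continuous hc) ε hε
  refine ⟨min δ 1, by positivity, fun t ht w hw => ?_⟩
  have := h (t, w) ⟨ht, by simpa using hw.trans (min_le_right _ _)⟩ (t, 0) ⟨ht, by simp⟩
    (by simpa [Prod.dist_eq] using hw.trans (min_le_left _ _))
  simpa [dist_eq_norm] using this

variable [NormedSpace ℝ V]

/-- Second order Taylor estimate from a first order estimate of the gradient. -/
lemma abs_taylor_remainder_le {f : V → ℝ} {z : V} {D : V →L[ℝ] V →L[ℝ] ℝ} {δ ε : ℝ}
    (hε : 0 ≤ ε) (hD : ∀ u v, D u v = D v u)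
    (hf : ∀ w, ‖w‖ ≤ δ → DifferentiableAt ℝ f (z + w))
    (hg : ∀ w, ‖w‖ ≤ δ → ‖fderiv ℝ f (z + w) - fderiv ℝ f z - D w‖ ≤ ε * ‖w‖)
    {w : V} (hw : ‖w‖ ≤ δ) :
    |f (z + w) - f z - fderiv ℝ f z w - 1 / 2 * D w w| ≤ ε * ‖w‖ ^ 2 := by
  -- The remainder is differentiated in `u`; symmetry of `D` makes the derivative of its quadratic
  -- part exactly `D u`. The mean value inequality on the ball of radius `‖w‖` then yields the
  -- second factor `‖w‖`.
  have hder : ∀ u ∈ Metric.closedBall (0 : V) ‖w‖,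
      HasFDerivWithinAt (fun u => f (z + u) - fderiv ℝ f z u - 1 / 2 * D u u)
        (fderiv ℝ f (z + u) - fderiv ℝ f z - D u) (Metric.closedBall (0 : V) ‖w‖) u := by
    intro u hu
    have hu' : ‖u‖ ≤ δ := (mem_closedBall_zero_iff.1 hu).trans hw
    have h1 : HasFDerivAt (fun u => f (z + u)) (fderiv ℝ f (z + u)) u := by
      have := (hf u hu').hasFDerivAt.comp u ((hasFDerivAt_id u).const_add z)
      exact this.congr_fderiv (by ext; simp)
    have h2 := (fderiv ℝ f z).hasFDerivAt (x := u)
    have h3 := ((D.hasFDerivAt (x := u)).clm_apply (hasFDerivAt_id u)).const_mul (1 / 2 : ℝ)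
    refine (((h1.sub h2).sub h3).congr_fderiv ?_).hasFDerivWithinAt
    ext v
    simp [hD v u]
    ring
  have hbound : ∀ u ∈ Metric.closedBall (0 : V) ‖w‖,
      ‖fderiv ℝ f (z + u) - fderiv ℝ f z - D u‖ ≤ ε * ‖w‖ := fun u hu => by
    have hu' := mem_closedBall_zero_iff.1 hu
    exact (hg u (hu'.trans hw)).trans (mul_le_mul_of_nonneg_left hu' hε)
  have := (convex_closedBall (0 : V) ‖w‖).norm_image_sub_le_of_norm_hasFDerivWithin_le hder hbound
    (x := 0) (y := w) (by simp) (by simp)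
  simp only [add_zero, map_zero, sub_zero, Real.norm_eq_abs, mul_zero] at this
  calc _ = |f (z + w) - fderiv ℝ f z w - 1 / 2 * D w w - f z| := by congr 1; ring
    _ ≤ _ := this
    _ = _ := by ring

/-- Second order Taylor expansion at a point, in `ε`-`δ` form. -/
lemma exists_taylor_of_contDiffAt {f : V → ℝ} {z : V} (hf : ContDiffAt ℝ 2 f z) {ε : ℝ}
    (hε : 0 < ε) : ∃ δ > 0, ∀ w, ‖w‖ ≤ δ →
      |f (z + w) - f z - fderiv ℝ f z w - 1 / 2 * fderiv ℝ (fderiv ℝ f) z w w| ≤ ε * ‖w‖ ^ 2 := by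
  have hsymm := hf.isSymmSndFDerivAt (by simp)
  have hdiff : DifferentiableAt ℝ (fderiv ℝ f) z :=
    (hf.fderiv_right (m := 1) (by norm_num)).differentiableAt (by norm_num)
  have h1 := hdiff.hasFDerivAt.isLittleO.def hε
  have h2 : ∀ᶠ u in nhds z, DifferentiableAt ℝ f u :=
    (hf.eventually (by simp)).mono fun u hu => hu.differentiableAt (by norm_num)
  obtain ⟨δ, hδ, hball⟩ := Metric.eventually_nhds_iff_ball.1 (h1.and h2)
  have hmem : ∀ w : V, ‖w‖ ≤ δ / 2 → z + w ∈ Metric.ball z δ := fun w hw => by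
    rw [mem_ball_iff_norm, add_sub_cancel_left]; linarith
  refine ⟨δ / 2, by positivity, fun w hw => abs_taylor_remainder_le (δ := δ / 2) hε.le
    (fun u v => hsymm.eq u v) (fun u hu => (hball _ (hmem u hu)).2) (fun u hu => ?_) hw⟩
  simpa using (hball _ (hmem u hu)).1

/-- The values at `0`, `1` and `-1` control the three coefficients by `M`, `M` and `2 M`, and all
powers of `l` are at most `l ^ 2`. -/
lemma abs_quadratic_le {a b c M l : ℝ} (h0 : |a| ≤ M) (h1 : |a + b + c| ≤ M)
    (h2 : |a - b + c| ≤ M) (hl : 1 ≤ l) : |a + b * l + c * l ^ 2| ≤ 4 * M * l ^ 2 := by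
  have hM : 0 ≤ M := (abs_nonneg a).trans h0
  rw [abs_le] at h0 h1 h2
  have hb : |b| ≤ M := abs_le.2 ⟨by linarith, by linarith⟩
  have hc : |c| ≤ 2 * M := abs_le.2 ⟨by linarith, by linarith⟩
  have hl2 : l ≤ l ^ 2 := by nlinarith
  calc |a + b * l + c * l ^ 2| ≤ |a| + |b * l| + |c * l ^ 2| := abs_add_three _ _ _
    _ = |a| + |b| * l + |c| * l ^ 2 := by
      rw [abs_mul, abs_mul, abs_of_nonneg (by linarith : 0 ≤ l), abs_of_nonneg (sq_nonneg l)]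
    _ ≤ M + M * l + 2 * M * l ^ 2 := by
      gcongr
      exact abs_le.2 h0
    _ ≤ 4 * M * l ^ 2 := by nlinarith

end Taylor

/-! ### Taylor remainder of a Lagrangian quadratic in the velocity -/

section Expansion

variable {n : ℕ} {T : ℝ} {ψ : ℝ → Vec n → Vec n → ℝ}

/-- `ψ(t,x,p)` is a quadratic polynomial in `p`. -/
def QuadraticInVelocity (T : ℝ) (ψ : ℝ → Vec n → Vec n → ℝ) : Prop :=
  ∀ t ∈ Icc 0 T, ∀ x p η : Vec n, ∃ a b c : ℝ, ∀ l : ℝ, ψ t x (p + l • η) = a + b * l + c * l ^ 2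

/-- The first derivative of `ψ(t,·,·)`. -/
def grad (ψ : ℝ → Vec n → Vec n → ℝ) (t : ℝ) (v : Vec n × Vec n) : Vec n × Vec n →L[ℝ] ℝ :=
  fderiv ℝ (fun v : Vec n × Vec n => ψ t v.1 v.2) v

/-- The second derivative of `ψ(t,·,·)`. -/
def hessian (ψ : ℝ → Vec n → Vec n → ℝ) (t : ℝ) (v : Vec n × Vec n) :
    Vec n × Vec n →L[ℝ] Vec n × Vec n →L[ℝ] ℝ :=
  fderiv ℝ (fderiv ℝ (fun v : Vec n × Vec n => ψ t v.1 v.2)) v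

lemma IsC2InSpace.hessian_symm (hψ : IsC2InSpace T ψ) {t : ℝ} (ht : t ∈ Icc 0 T)
    (v u w : Vec n × Vec n) : hessian ψ t v u w = hessian ψ t v w u :=
  ((hψ.contDiff t ht).contDiffAt.isSymmSndFDerivAt (by simp)).eq u w

lemma IsC2InSpace.continuousOn_comp (hψ : IsC2InSpace T ψ) {z : ℝ → Vec n × Vec n}
    (hz : ContinuousOn z (Icc 0 T)) :
    ContinuousOn (fun t => ψ t (z t).1 (z t).2) (Icc 0 T) :=
  hψ.continuousOn.comp (continuousOn_id.prodMk hz) fun _ ht => ⟨ht, mem_univ _⟩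

lemma IsC2InSpace.continuousOn_grad (hψ : IsC2InSpace T ψ) {z : ℝ → Vec n × Vec n}
    (hz : ContinuousOn z (Icc 0 T)) : ContinuousOn (fun t => grad ψ t (z t)) (Icc 0 T) :=
  hψ.continuousOn_fderiv.comp (continuousOn_id.prodMk hz) fun _ ht => ⟨ht, mem_univ _⟩

lemma IsC2InSpace.continuousOn_hessian (hψ : IsC2InSpace T ψ) {z : ℝ → Vec n × Vec n}
    (hz : ContinuousOn z (Icc 0 T)) : ContinuousOn (fun t => hessian ψ t (z t)) (Icc 0 T) :=
  hψ.continuousOn_fderiv_fderiv.comp (continuousOn_id.prodMk hz) fun _ ht => ⟨ht, mem_univ _⟩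

/-- The second order Taylor remainder of `ψ(t,·,·)` at `z`. -/
def remainder (ψ : ℝ → Vec n → Vec n → ℝ) (t : ℝ) (z : Vec n × Vec n) (ξ η : Vec n) : ℝ :=
  ψ t (z.1 + ξ) (z.2 + η) - ψ t z.1 z.2 - grad ψ t z (ξ, η) -
    1 / 2 * hessian ψ t z (ξ, η) (ξ, η)

/-- The Taylor remainder is uniformly small for small `ξ` and arbitrary `η`, since `ψ` is quadratic
in the velocity. -/
lemma IsC2InSpace.exists_remainder_le (hψ : IsC2InSpace T ψ) (hquad : QuadraticInVelocity T ψ)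
    {z : ℝ → Vec n × Vec n} (hz : ContinuousOn z (Icc 0 T)) {ε : ℝ} (hε : 0 < ε) :
    ∃ δ > 0, ∀ t ∈ Icc 0 T, ∀ ξ η : Vec n, ‖ξ‖ ≤ δ →
      |remainder ψ t (z t) ξ η| ≤ ε * (‖ξ‖ ^ 2 + ‖η‖ ^ 2) := by
  -- The quarter absorbs the factor `4` lost in `abs_quadratic_le`.
  obtain ⟨δ, hδ, hmod⟩ := exists_uniform_modulus
    (W := Vec n × Vec n →L[ℝ] Vec n × Vec n →L[ℝ] ℝ) hψ.continuousOn_fderiv_fderiv hz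
    (ε := ε / 4) (by positivity)
  have hloc : ∀ t ∈ Icc 0 T, ∀ w : Vec n × Vec n, ‖w‖ ≤ δ →
      |remainder ψ t (z t) w.1 w.2| ≤ ε / 4 * ‖w‖ ^ 2 := by
    intro t ht w hw
    refine abs_taylor_remainder_le (f := fun v : Vec n × Vec n => ψ t v.1 v.2) (δ := δ)
      (D := hessian ψ t (z t)) (by positivity) (hψ.hessian_symm ht (z t))
      (fun u _ => ((hψ.contDiff t ht).differentiable (by norm_num)) _) (fun u hu => ?_) hw
    have hd : Differentiable ℝ (fderiv ℝ (fun v : Vec n × Vec n => ψ t v.1 v.2)) :=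
      ((hψ.contDiff t ht).fderiv_right (m := 1) (by norm_num)).differentiable (by norm_num)
    have := (convex_closedBall (z t) δ).norm_image_sub_le_of_norm_fderiv_le'
      (f := fderiv ℝ (fun v : Vec n × Vec n => ψ t v.1 v.2)) (φ := hessian ψ t (z t))
      (C := ε / 4) (x := z t) (y := z t + u) (fun v _ => hd v) (fun v hv => by
        have := hmod t ht (v - z t) (by simpa [dist_eq_norm] using hv)
        rwa [add_sub_cancel] at this) (by simp [hδ.le]) (by simpa using hu)
    simpa using this
  refine ⟨δ, hδ, fun t ht ξ η hξ => ?_⟩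
  rcases le_or_gt ‖η‖ δ with hη | hη
  · have h1 := hloc t ht (ξ, η) (by simpa [Prod.norm_def] using ⟨hξ, hη⟩)
    have h2 : ‖((ξ, η) : Vec n × Vec n)‖ ^ 2 ≤ ‖ξ‖ ^ 2 + ‖η‖ ^ 2 := by
      rw [Prod.norm_def]
      rcases max_choice ‖ξ‖ ‖η‖ with h | h <;> simp only [h] <;>
        linarith [sq_nonneg ‖ξ‖, sq_nonneg ‖η‖]
    have h3 : 0 ≤ ‖ξ‖ ^ 2 + ‖η‖ ^ 2 := by positivity
    have h4 := mul_le_mul_of_nonneg_left h2 (by positivity : 0 ≤ ε / 4)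
    have h5 := mul_nonneg hε.le h3
    simp only at h1
    linarith
  -- For a large velocity, scale `η` back to a vector `η₀` of length `δ`. On the line through `η₀`
  -- the remainder is a quadratic polynomial, controlled near the origin by `hloc` and extrapolated
  -- to `l = ‖η‖ / δ`.
  · have hη0 : 0 < ‖η‖ := hδ.trans hη
    set η₀ : Vec n := (δ / ‖η‖) • η with hη₀
    have hη₀n : ‖η₀‖ = δ := by
      rw [hη₀, norm_smul, Real.norm_eq_abs, abs_of_pos (by positivity), div_mul_cancel₀ _ hη0.ne']
    set l := ‖η‖ / δ with hl
    have hl1 : 1 ≤ l := (one_le_div hδ).2 hη.le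
    have hηl : η = l • η₀ := by
      rw [hη₀, smul_smul, hl, div_mul_div_cancel₀ hδ.ne', div_self hη0.ne', one_smul]
    have hpoly : ∃ a b c : ℝ, ∀ l : ℝ, remainder ψ t (z t) ξ (l • η₀) = a + b * l + c * l ^ 2 := by
      obtain ⟨a, b, c, h⟩ := hquad t ht ((z t).1 + ξ) (z t).2 η₀
      set G := grad ψ t (z t)
      set D := hessian ψ t (z t)
      refine ⟨a - ψ t (z t).1 (z t).2 - G (ξ, 0) - 1 / 2 * D (ξ, 0) (ξ, 0),
        b - G (0, η₀) - D (ξ, 0) (0, η₀), c - 1 / 2 * D (0, η₀) (0, η₀), fun l => ?_⟩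
      have e : ((ξ, l • η₀) : Vec n × Vec n) = (ξ, 0) + l • (0, η₀) := by simp
      have hs : D (0, η₀) (ξ, 0) = D (ξ, 0) (0, η₀) := hψ.hessian_symm ht _ _ _
      rw [remainder, h l, e]
      simp only [map_add, map_smul, add_apply, smul_apply, smul_eq_mul]
      change _ - _ - (G (ξ, 0) + l * G (0, η₀)) - 1 / 2 * (D (ξ, 0) (ξ, 0) + l * D (0, η₀) (ξ, 0) +
        l * (D (ξ, 0) (0, η₀) + l * D (0, η₀) (0, η₀))) = _
      rw [hs]
      ring
    obtain ⟨a, b, c, h⟩ := hpoly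
    have hM : ∀ m : ℝ, |m| ≤ 1 → |a + b * m + c * m ^ 2| ≤ ε / 4 * δ ^ 2 := by
      intro m hm
      rw [← h m]
      have hw : ‖((ξ, m • η₀) : Vec n × Vec n)‖ ≤ δ := by
        rw [Prod.norm_def]
        refine max_le hξ ?_
        simp only [norm_smul, hη₀n, Real.norm_eq_abs]
        nlinarith
      refine (hloc t ht (ξ, m • η₀) hw).trans ?_
      gcongr
    have h0 := hM 0 (by simp)
    have h1 := hM 1 (by simp)
    have h2 := hM (-1) (by simp)
    have h3 := abs_quadratic_le (a := a) (b := b) (c := c) (by simpa using h0) (by simpa using h1)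
      (by convert h2 using 2; ring) hl1
    rw [hηl, h l, ← hηl]
    refine h3.trans ?_
    have : 4 * (ε / 4 * δ ^ 2) * l ^ 2 = ε * ‖η‖ ^ 2 := by rw [hl]; field_simp
    rw [this]
    gcongr
    linarith [sq_nonneg ‖ξ‖]

end Expansion

/-! ### Paths of class C¹ and the energy -/

section Paths

variable {n : ℕ} {T : ℝ} {ξ x : ℝ → Vec n}

lemma IsC1Path.hasDerivWithinAt (hξ : IsC1Path T ξ) {t : ℝ} (ht : t ∈ Icc 0 T) :
    HasDerivWithinAt ξ (vel T ξ t) (Icc 0 T) t :=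
  ((ContDiffOn.differentiableOn hξ (by norm_num)) t ht).hasDerivWithinAt

lemma IsC1Path.continuousOn (hξ : IsC1Path T ξ) : ContinuousOn ξ (Icc 0 T) :=
  ContDiffOn.continuousOn hξ

lemma IsC1Path.continuousOn_vel (hT : 0 < T) (hξ : IsC1Path T ξ) :
    ContinuousOn (vel T ξ) (Icc 0 T) :=
  ContDiffOn.continuousOn_derivWithin hξ (uniqueDiffOn_Icc hT) le_rfl

lemma vel_eq_of_hasDerivWithinAt (hT : 0 < T) {w : Vec n} {t : ℝ} (ht : t ∈ Icc 0 T)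
    (h : HasDerivWithinAt ξ w (Icc 0 T) t) : vel T ξ t = w :=
  h.derivWithin (uniqueDiffOn_Icc hT t ht)

lemma isC1Path_of_hasDerivWithinAt (hT : 0 < T) {w : ℝ → Vec n}
    (h : ∀ t ∈ Icc 0 T, HasDerivWithinAt ξ (w t) (Icc 0 T) t) (hw : ContinuousOn w (Icc 0 T)) :
    IsC1Path T ξ := by
  have : ContDiffOn ℝ (0 + 1) ξ (Icc 0 T) := by
    rw [contDiffOn_succ_iff_derivWithin (uniqueDiffOn_Icc hT)]
    refine ⟨fun t ht => (h t ht).differentiableWithinAt, by simp, ?_⟩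
    rw [contDiffOn_zero]
    exact hw.congr fun t ht => vel_eq_of_hasDerivWithinAt hT ht (h t ht)
  simpa [IsC1Path] using this

lemma IsC1Path.add (hx : IsC1Path T x) (hξ : IsC1Path T ξ) : IsC1Path T (x + ξ) :=
  ContDiffOn.add hx hξ

lemma IsC1Path.const_smul (h : ℝ) (hξ : IsC1Path T ξ) : IsC1Path T (h • ξ) :=
  ContDiffOn.const_smul h hξ

lemma IsC1Path.vel_add (hT : 0 < T) (hx : IsC1Path T x) (hξ : IsC1Path T ξ) {t : ℝ}
    (ht : t ∈ Icc 0 T) : vel T (x + ξ) t = vel T x t + vel T ξ t :=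
  vel_eq_of_hasDerivWithinAt hT ht ((hx.hasDerivWithinAt ht).add (hξ.hasDerivWithinAt ht))

lemma IsC1Path.vel_const_smul (hT : 0 < T) (h : ℝ) (hξ : IsC1Path T ξ) {t : ℝ}
    (ht : t ∈ Icc 0 T) : vel T (h • ξ) t = h • vel T ξ t :=
  vel_eq_of_hasDerivWithinAt hT ht ((hξ.hasDerivWithinAt ht).const_smul h)

lemma IsC1Path.continuousOn_energy (hT : 0 < T) (hξ : IsC1Path T ξ) :
    ContinuousOn (fun t => ‖ξ t‖ ^ 2 + ‖vel T ξ t‖ ^ 2) (Icc 0 T) :=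
  (hξ.continuousOn.norm.pow 2).add ((hξ.continuousOn_vel hT).norm.pow 2)

lemma energy_nonneg (hT : 0 < T) (ξ : ℝ → Vec n) : 0 ≤ energy T ξ :=
  intervalIntegral.integral_nonneg hT.le fun t _ => by positivity

lemma IsC1Path.energy_const_smul (hT : 0 < T) (h : ℝ) (hξ : IsC1Path T ξ) :
    energy T (h • ξ) = h ^ 2 * energy T ξ := by
  unfold energy
  rw [← intervalIntegral.integral_const_mul]
  refine intervalIntegral.integral_congr fun t ht => ?_
  rw [uIcc_of_le hT.le] at ht
  simp only [hξ.vel_const_smul hT h ht, Pi.smul_apply, norm_smul, mul_pow, Real.norm_eq_abs,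
    sq_abs]
  ring

/-- The one-dimensional Sobolev inequality. -/
lemma IsC1Path.norm_sq_le_energy (hT : 0 < T) (hξ : IsC1Path T ξ) {t : ℝ} (ht : t ∈ Icc 0 T) :
    ‖ξ t‖ ^ 2 ≤ (1 + T⁻¹) * energy T ξ := by
  have hc := hξ.continuousOn
  have hv := hξ.continuousOn_vel hT
  have hei := (hξ.continuousOn_energy hT).intervalIntegrable_of_Icc (μ := volume) hT.le
  have hgi := (hc.norm.pow 2).intervalIntegrable_of_Icc (μ := volume) hT.le
  -- At a minimum point `s`, `‖ξ s‖ ^ 2` is at most the mean value. The increment from `s` to `t` is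
  -- the integral of `2 ⟪ξ, ξ̇⟫`, at most the energy.
  obtain ⟨s, hs, hmin⟩ := isCompact_Icc.exists_isMinOn (nonempty_Icc.2 hT.le) (hc.norm.pow 2)
  have h1 : T * ‖ξ s‖ ^ 2 ≤ energy T ξ := by
    have h := intervalIntegral.integral_mono_on hT.le
      (f := fun _ => ‖ξ s‖ ^ 2) (by simp) hei (fun u hu => ?_)
    · simpa [energy] using h
    · have : ‖ξ s‖ ^ 2 ≤ ‖ξ u‖ ^ 2 := hmin hu
      linarith [sq_nonneg ‖vel T ξ u‖]
  have hsub : uIcc s t ⊆ Icc 0 T := uIcc_subset_Icc hs ht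
  have hd : ∀ u ∈ Icc 0 T, HasDerivWithinAt (fun u => ‖ξ u‖ ^ 2)
      (2 * inner ℝ (ξ u) (vel T ξ u)) (Icc 0 T) u := fun u hu => (hξ.hasDerivWithinAt hu).norm_sq
  have hdc : ContinuousOn (fun u => 2 * inner ℝ (ξ u) (vel T ξ u)) (Icc 0 T) :=
    continuousOn_const.mul (hc.inner hv)
  have ftc : ∫ u in s..t, 2 * inner ℝ (ξ u) (vel T ξ u) = ‖ξ t‖ ^ 2 - ‖ξ s‖ ^ 2 := by
    refine intervalIntegral.integral_eq_sub_of_hasDeriv_right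
      (fun u hu => (hd u (hsub hu)).continuousWithinAt.mono hsub) (fun u hu => ?_)
      (hdc.mono hsub).intervalIntegrable
    have hu' : 0 < u ∧ u < T :=
      ⟨(le_min hs.1 ht.1).trans_lt hu.1, hu.2.trans_le (max_le hs.2 ht.2)⟩
    exact ((hd u ⟨hu'.1.le, hu'.2.le⟩).hasDerivAt (Icc_mem_nhds hu'.1 hu'.2)).hasDerivWithinAt
  have h2 : ‖ξ t‖ ^ 2 - ‖ξ s‖ ^ 2 ≤ energy T ξ := by
    rw [← ftc]
    have hsub' : Set.uIoc s t ⊆ Set.uIoc 0 T := by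
      rw [uIoc_of_le hT.le]
      exact Ioc_subset_Ioc (le_min hs.1 ht.1) (max_le hs.2 ht.2)
    have hni := hdc.norm.intervalIntegrable_of_Icc (μ := volume) hT.le
    calc _ ≤ ‖∫ u in s..t, 2 * inner ℝ (ξ u) (vel T ξ u)‖ := Real.le_norm_self _
      _ ≤ |∫ u in s..t, ‖2 * inner ℝ (ξ u) (vel T ξ u)‖| :=
        intervalIntegral.norm_integral_le_abs_integral_norm
      _ ≤ |∫ u in (0 : ℝ)..T, ‖2 * inner ℝ (ξ u) (vel T ξ u)‖| :=
        intervalIntegral.abs_integral_mono_interval hsub'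
          (Filter.Eventually.of_forall fun u => norm_nonneg _) hni
      _ = ∫ u in (0 : ℝ)..T, ‖2 * inner ℝ (ξ u) (vel T ξ u)‖ :=
        abs_of_nonneg (intervalIntegral.integral_nonneg hT.le fun u _ => norm_nonneg _)
      _ ≤ energy T ξ := by
        refine intervalIntegral.integral_mono_on hT.le hni hei fun u _ => ?_
        rw [norm_mul, Real.norm_ofNat]
        have := norm_inner_le_norm (𝕜 := ℝ) (ξ u) (vel T ξ u)
        nlinarith [sq_nonneg (‖ξ u‖ - ‖vel T ξ u‖)]
  have h3 : ‖ξ s‖ ^ 2 ≤ T⁻¹ * energy T ξ := by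
    rw [inv_mul_eq_div, le_div_iff₀ hT]; linarith
  linarith

end Paths

/-! ### First and second variation of the action -/

section Variation

variable {n : ℕ} {T : ℝ} {ψ : ℝ → Vec n → Vec n → ℝ} {φ : Vec n → ℝ} {x ξ : ℝ → Vec n}

/-- The action of a path. -/
def action (T : ℝ) (ψ : ℝ → Vec n → Vec n → ℝ) (φ : Vec n → ℝ) (x : ℝ → Vec n) : ℝ :=
  (∫ t in (0 : ℝ)..T, ψ t (x t) (vel T x t)) + φ (x 0)

/-- The first variation of the action at `x` in direction `ξ`. -/
def firstVar (T : ℝ) (ψ : ℝ → Vec n → Vec n → ℝ) (φ : Vec n → ℝ) (x ξ : ℝ → Vec n) : ℝ :=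
  fderiv ℝ φ (x 0) (ξ 0) + ∫ t in (0 : ℝ)..T, grad ψ t (x t, vel T x t) (ξ t, vel T ξ t)

/-- The second variation of the action at `x` in direction `ξ`. -/
def secondVar (T : ℝ) (ψ : ℝ → Vec n → Vec n → ℝ) (φ : Vec n → ℝ) (x ξ : ℝ → Vec n) : ℝ :=
  fderiv ℝ (fderiv ℝ φ) (x 0) (ξ 0) (ξ 0) + ∫ t in (0 : ℝ)..T,
    hessian ψ t (x t, vel T x t) (ξ t, vel T ξ t) (ξ t, vel T ξ t)

lemma IsC1Path.firstVar_const_smul (hT : 0 < T) (hξ : IsC1Path T ξ) (h : ℝ) :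
    firstVar T ψ φ x (h • ξ) = h * firstVar T ψ φ x ξ := by
  unfold firstVar
  rw [mul_add, ← intervalIntegral.integral_const_mul]
  congr 1
  · simp
  · refine intervalIntegral.integral_congr fun t ht => ?_
    rw [uIcc_of_le hT.le] at ht
    simp only [hξ.vel_const_smul hT h ht, Pi.smul_apply, ← Prod.smul_mk, map_smul, smul_eq_mul]

lemma IsC1Path.secondVar_const_smul (hT : 0 < T) (hξ : IsC1Path T ξ) (h : ℝ) :
    secondVar T ψ φ x (h • ξ) = h ^ 2 * secondVar T ψ φ x ξ := by
  unfold secondVar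
  rw [mul_add, ← intervalIntegral.integral_const_mul]
  congr 1
  · simp; ring
  · refine intervalIntegral.integral_congr fun t ht => ?_
    rw [uIcc_of_le hT.le] at ht
    simp only [hξ.vel_const_smul hT h ht, Pi.smul_apply, ← Prod.smul_mk, map_smul, smul_apply,
      smul_eq_mul]
    ring

/-- Second order expansion of the action, with an error controlled by the energy. -/
theorem exists_action_expansion (hT : 0 < T) (hψ : IsC2InSpace T ψ)
    (hquad : QuadraticInVelocity T ψ) (hx : IsC1Path T x) (hφ : ContDiffAt ℝ 2 φ (x 0))
    {ε : ℝ} (hε : 0 < ε) : ∃ δ > 0, ∀ ξ, IsC1Path T ξ → energy T ξ < δ →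
      |action T ψ φ (x + ξ) - action T ψ φ x - firstVar T ψ φ x ξ - 1 / 2 * secondVar T ψ φ x ξ| ≤
        ε * energy T ξ := by
  have hz : ContinuousOn (fun t => (x t, vel T x t)) (Icc 0 T) :=
    hx.continuousOn.prodMk (hx.continuousOn_vel hT)
  set C := 1 + T⁻¹ with hC
  have hCpos : 0 < C := by positivity
  obtain ⟨δ₁, hδ₁, h₁⟩ := hψ.exists_remainder_le hquad hz (ε := ε / 2) (by positivity)
  obtain ⟨δ₂, hδ₂, h₂⟩ := exists_taylor_of_contDiffAt hφ (ε := ε / 2 / C) (by positivity)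
  -- With the Sobolev constant `C`, this energy threshold brings `ξ` uniformly within both Taylor
  -- radii. No smallness of the velocity is required.
  refine ⟨(min δ₁ δ₂) ^ 2 / C, by positivity, fun ξ hξ hE => ?_⟩
  have hsmall : ∀ t ∈ Icc 0 T, ‖ξ t‖ ≤ min δ₁ δ₂ := fun t ht => by
    refine (sq_le_sq₀ (norm_nonneg _) (by positivity)).1
      ((hξ.norm_sq_le_energy hT ht).trans ?_)
    rw [lt_div_iff₀ hCpos] at hE
    linarith
  have hw : ContinuousOn (fun t => (ξ t, vel T ξ t)) (Icc 0 T) :=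
    hξ.continuousOn.prodMk (hξ.continuousOn_vel hT)
  have hI1 : IntervalIntegrable (fun t => ψ t (x t + ξ t) (vel T x t + vel T ξ t)) volume 0 T :=
    (hψ.continuousOn_comp (hz.add hw)).intervalIntegrable_of_Icc (μ := volume) hT.le
  have hI0 := (hψ.continuousOn_comp hz).intervalIntegrable_of_Icc (μ := volume) hT.le
  have hIG := ((hψ.continuousOn_grad hz).clm_apply hw).intervalIntegrable_of_Icc
    (μ := volume) hT.le
  have hIH := ((((hψ.continuousOn_hessian hz).clm_apply hw).clm_apply
    hw).intervalIntegrable_of_Icc (μ := volume) hT.le).const_mul (1 / 2 : ℝ)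
  have hR := intervalIntegral.integral_sub ((hI1.sub hI0).sub hIG) hIH
  rw [intervalIntegral.integral_sub (hI1.sub hI0) hIG, intervalIntegral.integral_sub hI1 hI0,
    intervalIntegral.integral_const_mul] at hR
  have hRle : |∫ t in (0 : ℝ)..T, remainder ψ t (x t, vel T x t) (ξ t) (vel T ξ t)| ≤
      ε / 2 * energy T ξ := by
    rw [energy, ← intervalIntegral.integral_const_mul, ← Real.norm_eq_abs]
    refine intervalIntegral.norm_integral_le_of_norm_le hT.le
      (Filter.Eventually.of_forall fun t ht => ?_) ?_
    · have ht' := Ioc_subset_Icc_self ht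
      exact h₁ t ht' _ _ ((hsmall t ht').trans (min_le_left _ _))
    · exact ((continuousOn_const).mul (hξ.continuousOn_energy hT)).intervalIntegrable_of_Icc hT.le
  have hI1' : ∫ t in (0 : ℝ)..T, ψ t ((x + ξ) t) (vel T (x + ξ) t) =
      ∫ t in (0 : ℝ)..T, ψ t (x t + ξ t) (vel T x t + vel T ξ t) := by
    refine intervalIntegral.integral_congr fun t ht => ?_
    rw [uIcc_of_le hT.le] at ht
    simp only [hx.vel_add hT hξ ht, Pi.add_apply]
  have h0 : (0 : ℝ) ∈ Icc 0 T := left_mem_Icc.2 hT.le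
  have hφle : |φ (x 0 + ξ 0) - φ (x 0) - fderiv ℝ φ (x 0) (ξ 0) -
      1 / 2 * fderiv ℝ (fderiv ℝ φ) (x 0) (ξ 0) (ξ 0)| ≤ ε / 2 * energy T ξ := by
    refine (h₂ (ξ 0) ((hsmall 0 h0).trans (min_le_right _ _))).trans ?_
    have := mul_le_mul_of_nonneg_left (hξ.norm_sq_le_energy hT h0)
      (by positivity : 0 ≤ ε / 2 / C)
    refine this.trans (le_of_eq ?_)
    rw [← hC]
    field_simp
  have e : action T ψ φ (x + ξ) - action T ψ φ x - firstVar T ψ φ x ξ -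
      1 / 2 * secondVar T ψ φ x ξ =
      (∫ t in (0 : ℝ)..T, remainder ψ t (x t, vel T x t) (ξ t) (vel T ξ t)) +
      (φ (x 0 + ξ 0) - φ (x 0) - fderiv ℝ φ (x 0) (ξ 0) -
        1 / 2 * fderiv ℝ (fderiv ℝ φ) (x 0) (ξ 0) (ξ 0)) := by
    have hR' : (∫ t in (0 : ℝ)..T, remainder ψ t (x t, vel T x t) (ξ t) (vel T ξ t)) = _ := hR
    rw [hR', action, hI1', action, firstVar, secondVar, Pi.add_apply]
    ring
  rw [e]
  refine (abs_add_le _ _).trans ?_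
  linarith

/-- For small `h` of suitable sign a nonzero linear term would dominate. Once it is gone, a negative
`S` would outweigh the error for small `ε`. -/
lemma eq_zero_and_nonneg_of_expansion {L S N : ℝ} (hN : 0 ≤ N)
    (H : ∀ ε > 0, ∃ h₀ > 0, ∀ h : ℝ, |h| < h₀ →
      0 ≤ h * L + 1 / 2 * (h ^ 2 * S) + ε * (h ^ 2 * N)) : L = 0 ∧ 0 ≤ S := by
  have hL : L = 0 := by
    obtain ⟨h₀, hh₀, H1⟩ := H 1 one_pos
    by_contra hL
    -- The step `k` keeps the second order part below half the linear one; `h` is taken with sign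
    -- opposite to `L`.
    set c := |1 / 2 * S + N| + 1 with hc
    have hcpos : 0 < c := by positivity
    have hLpos : 0 < |L| := abs_pos.2 hL
    set k := min (h₀ / 2) (|L| / (2 * c)) with hk
    have hkpos : 0 < k := by positivity
    have hk1 : k < h₀ := (min_le_left _ _).trans_lt (by linarith)
    have hk2 : k * (2 * c) ≤ |L| := (le_div_iff₀ (by positivity)).1 (min_le_right _ _)
    have hk3 : k * (1 / 2 * S + N) ≤ k * c :=
      mul_le_mul_of_nonneg_left ((le_abs_self _).trans (by linarith)) hkpos.le
    rcases lt_or_gt_of_ne hL with h | h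
    · have := H1 k (by rwa [abs_of_pos hkpos])
      rw [abs_of_neg h] at hk2 hLpos
      have h2 : 0 ≤ k * (L + k * (1 / 2 * S + N)) := by linarith
      have := nonneg_of_mul_nonneg_right h2 hkpos
      linarith
    · have := H1 (-k) (by rwa [abs_neg, abs_of_pos hkpos])
      rw [abs_of_pos h] at hk2
      have h2 : 0 ≤ k * (-L + k * (1 / 2 * S + N)) := by linarith
      have := nonneg_of_mul_nonneg_right h2 hkpos
      linarith
  refine ⟨hL, ?_⟩
  by_contra hS
  push Not at hS
  -- This `ε` makes `ε * N ≤ -S / 4`, leaving at most `S / 4 < 0` as coefficient of `h ^ 2`.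
  obtain ⟨h₀, hh₀, H1⟩ := H (-S / (4 * (N + 1))) (div_pos (by linarith) (by linarith))
  have h1 := H1 (h₀ / 2) (by rw [abs_of_pos (by linarith)]; linarith)
  have h2 : -S / (4 * (N + 1)) * N ≤ -S / 4 := by
    rw [div_mul_eq_mul_div, div_le_div_iff₀ (by linarith) (by norm_num)]
    nlinarith
  have h3 : 0 < (h₀ / 2) ^ 2 := by positivity
  have h4 := mul_le_mul_of_nonneg_left h2 h3.le
  have h5 := mul_neg_of_pos_of_neg h3 hS
  rw [hL] at h1
  linarith

/-- At a local minimizer the first variation vanishes and the second one is nonnegative. -/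
theorem IsLocalMinimizer.variation (hT : 0 < T) (hψ : IsC2InSpace T ψ)
    (hquad : QuadraticInVelocity T ψ) (hφ : ContDiffAt ℝ 2 φ (x 0))
    (hmin : IsLocalMinimizer T (action T ψ φ) x) (hξ : IsC1Path T ξ) :
    firstVar T ψ φ x ξ = 0 ∧ 0 ≤ secondVar T ψ φ x ξ := by
  obtain ⟨hx, ε₀, hε₀, hloc⟩ := hmin
  obtain ⟨C, hC⟩ := isCompact_Icc.exists_bound_of_continuousOn hξ.continuousOn
  obtain ⟨D, hD⟩ := isCompact_Icc.exists_bound_of_continuousOn (hξ.continuousOn_vel hT)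
  have hN := energy_nonneg hT ξ
  refine eq_zero_and_nonneg_of_expansion hN fun ε hε => ?_
  obtain ⟨δ, hδ, hexp⟩ := exists_action_expansion hT hψ hquad hx hφ hε
  set M := |C| + |D| + 1 with hM
  have hMpos : 0 < M := by positivity
  -- The first bound keeps `x + h • ξ` in the C¹ neighbourhood of minimality, the second keeps the
  -- energy of `h • ξ` below `δ`.
  refine ⟨min (ε₀ / M) (Real.sqrt (δ / (energy T ξ + 1))), by positivity, fun h hh => ?_⟩
  have hh1 : |h| * M < ε₀ := (lt_div_iff₀ hMpos).1 (hh.trans_le (min_le_left _ _))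
  have hh2 : h ^ 2 * (energy T ξ + 1) < δ := by
    rw [← lt_div_iff₀ (by positivity), ← sq_abs]
    exact (Real.lt_sqrt (abs_nonneg h)).1 (hh.trans_le (min_le_right _ _))
  have hhξ := hξ.const_smul h
  have h1 := hloc (x + h • ξ) (hx.add hhξ) fun t ht => by
    rw [hx.vel_add hT hhξ ht, hξ.vel_const_smul hT h ht]
    simp only [Pi.add_apply, Pi.smul_apply, add_sub_cancel_left, norm_smul, Real.norm_eq_abs]
    have hc := (hC t ht).trans (le_abs_self C)
    have hd := (hD t ht).trans (le_abs_self D)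
    constructor
    · refine lt_of_le_of_lt (mul_le_mul_of_nonneg_left ?_ (abs_nonneg h)) hh1
      linarith [abs_nonneg D]
    · refine lt_of_le_of_lt (mul_le_mul_of_nonneg_left ?_ (abs_nonneg h)) hh1
      linarith [abs_nonneg C]
  have h2 := hexp (h • ξ) hhξ (by
    rw [hξ.energy_const_smul hT]
    linarith [sq_nonneg h])
  rw [hξ.firstVar_const_smul hT, hξ.secondVar_const_smul hT, hξ.energy_const_smul hT] at h2
  have h3 := (abs_le.1 h2).2
  linarith

end Variation

/-! ### The Lagrangian `psi`: quadratic in the velocity, strictly convex -/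

section Lagrangian

variable {n s : ℕ} {T : ℝ} {σ : ℝ → State n s → StateMat n s} {μ : ℝ → State n s → State n s}
  {y : ℝ → Vec s}

lemma psi_add_smul (t : ℝ) (x p η : Vec n) : ∃ a b : ℝ, ∀ l : ℝ,
    psi T σ μ y t x (p + l • η) = a + b * l +
      1 / 2 * ‖WithLp.toLp 2 ((σ t (stack x (y t)))⁻¹ *ᵥ (stack η (0 : Vec s)).ofLp)‖ ^ 2 *
        l ^ 2 := by
  set M := (σ t (stack x (y t)))⁻¹
  set w : State n s := WithLp.toLp 2 (M *ᵥ (stack η (0 : Vec s)).ofLp) with hw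
  set u : State n s := WithLp.toLp 2 (M *ᵥ (stack p (vel T y t) - μ t (stack x (y t))).ofLp)
    with hu
  refine ⟨1 / 2 * ‖u‖ ^ 2, inner ℝ u w, fun l => ?_⟩
  have hst : stack (p + l • η) (vel T y t) = stack p (vel T y t) + l • stack η (0 : Vec s) := by
    ext i
    rcases i with i | i <;> simp [stack]
  have e : WithLp.toLp 2 (M *ᵥ (stack (p + l • η) (vel T y t) - μ t (stack x (y t))).ofLp) =
      u + l • w := by
    rw [hst, add_sub_right_comm, WithLp.ofLp_add, Matrix.mulVec_add, WithLp.ofLp_smul,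
      Matrix.mulVec_smul, WithLp.toLp_add, WithLp.toLp_smul]
  rw [psi, e, norm_add_sq_real, inner_smul_right, norm_smul, Real.norm_eq_abs, mul_pow, sq_abs]
  ring

lemma quadraticInVelocity_psi : QuadraticInVelocity T (psi (n := n) T σ μ y) := by
  intro t _ x p η
  obtain ⟨a, b, h⟩ := psi_add_smul (T := T) (σ := σ) (μ := μ) (y := y) t x p η
  exact ⟨a, b, _, h⟩

/-- Differentiate twice along the line through `z` in direction `w`, once by the chain rule and once
from the polynomial, and compare. -/
lemma snd_fderiv_eq_of_quadratic {V : Type*} [NormedAddCommGroup V] [NormedSpace ℝ V] {f : V → ℝ}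
    (hf : ContDiff ℝ 2 f) {z w : V} {a b c : ℝ}
    (h : ∀ l : ℝ, f (z + l • w) = a + b * l + c * l ^ 2) :
    fderiv ℝ (fderiv ℝ f) z w w = 2 * c := by
  have hline : ∀ l : ℝ, HasDerivAt (fun l : ℝ => z + l • w) w l := fun l => by
    simpa using ((hasDerivAt_id l).smul_const w).const_add z
  have hd1 : ∀ l : ℝ, HasDerivAt (fun l : ℝ => f (z + l • w)) (fderiv ℝ f (z + l • w) w) l :=
    fun l => ((hf.differentiable (by norm_num)) (z + l • w)).hasFDerivAt.comp_hasDerivAt l (hline l)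
  have h1 : ∀ l : ℝ, fderiv ℝ f (z + l • w) w = b + 2 * c * l := fun l => by
    have e2 : HasDerivAt (fun l : ℝ => a + b * l + c * l ^ 2) (b + 2 * c * l) l := by
      refine ((((hasDerivAt_id l).const_mul b).const_add a).add
        ((hasDerivAt_pow 2 l).const_mul c)).congr_deriv ?_
      norm_num
      ring
    have e1 := hd1 l
    simp only [h] at e1
    exact e1.unique e2
  have hd : Differentiable ℝ (fderiv ℝ f) :=
    (hf.fderiv_right (m := 1) (by norm_num)).differentiable (by norm_num)
  have hd2 : HasDerivAt (fun l : ℝ => fderiv ℝ f (z + l • w))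
      (fderiv ℝ (fderiv ℝ f) (z + (0 : ℝ) • w) w) 0 :=
    (hd (z + (0 : ℝ) • w)).hasFDerivAt.comp_hasDerivAt (0 : ℝ) (hline 0)
  have e1 : HasDerivAt (fun l : ℝ => fderiv ℝ f (z + l • w) w)
      (fderiv ℝ (fderiv ℝ f) (z + (0 : ℝ) • w) w w) 0 :=
    (hd2.clm_apply (hasDerivAt_const (0 : ℝ) w)).congr_deriv (by rw [map_zero, add_zero])
  have e2 : HasDerivAt (fun l : ℝ => b + 2 * c * l) (2 * c) 0 := by
    simpa using ((hasDerivAt_id (0 : ℝ)).const_mul (2 * c)).const_add b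
  simp only [h1] at e1
  have e3 := e1.unique e2
  rwa [zero_smul, add_zero] at e3

lemma hessian_psi_velocity (hψ : IsC2InSpace T (psi (n := n) T σ μ y)) {t : ℝ}
    (ht : t ∈ Icc 0 T) (z : Vec n × Vec n) (η : Vec n) :
    hessian (psi T σ μ y) t z (0, η) (0, η) =
      ‖WithLp.toLp 2 ((σ t (stack z.1 (y t)))⁻¹ *ᵥ (stack η (0 : Vec s)).ofLp)‖ ^ 2 := by
  obtain ⟨a, b, h⟩ := psi_add_smul (T := T) (σ := σ) (μ := μ) (y := y) t z.1 z.2 η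
  have := snd_fderiv_eq_of_quadratic (hψ.contDiff t ht) (z := z) (w := (0, η)) (a := a) (b := b)
    (c := 1 / 2 * ‖WithLp.toLp 2 ((σ t (stack z.1 (y t)))⁻¹ *ᵥ (stack η (0 : Vec s)).ofLp)‖ ^ 2)
    (fun l => by simpa using h l)
  rw [hessian, this]
  ring

/-- The strict Legendre condition: `σ⁻¹` is injective and stacking `η` over zero loses nothing. -/
lemma hessian_psi_velocity_pos (hψ : IsC2InSpace T (psi (n := n) T σ μ y)) {t : ℝ}
    (ht : t ∈ Icc 0 T) (hσ : ∀ z, IsUnit (σ t z)) (z : Vec n × Vec n) {η : Vec n} (hη : η ≠ 0) :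
    0 < hessian (psi T σ μ y) t z (0, η) (0, η) := by
  rw [hessian_psi_velocity hψ ht]
  refine pow_pos (norm_pos_iff.2 fun h0 => hη ?_) 2
  have hu : IsUnit (σ t (stack z.1 (y t)))⁻¹ := Matrix.isUnit_nonsing_inv_iff.2 (hσ _)
  have h1 : (σ t (stack z.1 (y t)))⁻¹ *ᵥ (stack η (0 : Vec s)).ofLp = 0 := by
    simpa using congrArg WithLp.ofLp h0
  have h2 := Matrix.mulVec_injective_of_isUnit hu (h1.trans (Matrix.mulVec_zero _).symm)
  ext i
  simpa [stack] using congrFun h2 (Sum.inl i)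

end Lagrangian

/-! ### From matrices of partial derivatives to operators -/

section Matrices

variable {n : ℕ} {T : ℝ}

/-- The operator on `ℝⁿ` of a matrix. -/
abbrev toOp (M : Matrix (Fin n) (Fin n) ℝ) : Vec n →L[ℝ] Vec n :=
  Matrix.toEuclideanCLM (n := Fin n) (𝕜 := ℝ) M

lemma continuous_toOp : Continuous (toOp (n := n)) :=
  LinearMap.continuous_of_finiteDimensional
    (Matrix.toEuclideanCLM (n := Fin n) (𝕜 := ℝ)).toAlgEquiv.toLinearMap

lemma star_toOp (M : Matrix (Fin n) (Fin n) ℝ) : star (toOp M) = toOp Mᵀ := by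
  rw [toOp, ← map_star, Matrix.star_eq_conjTranspose, Matrix.conjTranspose_eq_transpose_of_trivial]

lemma hasDerivWithinAt_toOp_iff {θ : ℝ → Matrix (Fin n) (Fin n) ℝ}
    {θ' : Matrix (Fin n) (Fin n) ℝ} {s : Set ℝ} {t : ℝ} :
    HasDerivWithinAt (fun t => toOp (θ t)) (toOp θ') s t ↔ HasDerivWithinAt θ θ' s t := by
  -- A norm on matrices is chosen only inside the proof, to apply the chain rule to the linear
  -- equivalence underlying `toOp` and to its inverse.
  let _ : NormedAddCommGroup (Matrix (Fin n) (Fin n) ℝ) := Matrix.instL2OpNormedAddCommGroup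
  let _ : NormedSpace ℝ (Matrix (Fin n) (Fin n) ℝ) := Matrix.instL2OpNormedSpace
  set e := (Matrix.toEuclideanCLM (n := Fin n) (𝕜 := ℝ)).toAlgEquiv.toLinearEquiv.toContinuousLinearEquiv
  constructor
  · intro h
    have := e.symm.hasFDerivAt.comp_hasDerivWithinAt t h
    have hfun : (e.symm ∘ fun t => toOp (θ t)) = θ := funext fun t => e.symm_apply_apply (θ t)
    rw [hfun] at this
    exact this.congr_deriv (e.symm_apply_apply θ')
  · intro h
    exact e.hasFDerivAt.comp_hasDerivWithinAt t h

/-- The matrix of a bilinear form. -/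
lemma inner_toOp_of_entries {M : Matrix (Fin n) (Fin n) ℝ} {β : Vec n →ₗ[ℝ] Vec n →ₗ[ℝ] ℝ}
    (h : ∀ i j, M i j = β (EuclideanSpace.single i 1) (EuclideanSpace.single j 1)) (u v : Vec n) :
    inner ℝ u (toOp M v) = β u v := by
  have hu : ∀ u : Vec n, u = ∑ i, u i • EuclideanSpace.single i (1 : ℝ) := fun u => by
    have := ((EuclideanSpace.basisFun (Fin n) ℝ).sum_repr u).symm
    simpa using this
  rw [Matrix.inner_toEuclideanCLM]
  conv_rhs => rw [hu u, hu v]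
  simp only [map_sum, LinearMap.sum_apply, map_smul, LinearMap.smul_apply, smul_eq_mul,
    dotProduct, Matrix.mulVec, ← h, Finset.mul_sum]
  rw [Finset.sum_comm]
  refine Finset.sum_congr rfl fun i _ => Finset.sum_congr rfl fun j _ => ?_
  ring

variable {ψ : ℝ → Vec n → Vec n → ℝ} {x : ℝ → Vec n}

lemma hasFDerivAt_comp_prodMk_left {F : Vec n × Vec n → ℝ} {F' : Vec n × Vec n →L[ℝ] ℝ}
    {a p : Vec n} (h : HasFDerivAt F F' (a, p)) :
    HasFDerivAt (fun b => F (b, p)) (F'.comp (.inl ℝ (Vec n) (Vec n))) a :=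
  HasFDerivAt.comp (g := F) (f := fun b => (b, p)) a h (hasFDerivAt_prodMk_left a p)

lemma hasFDerivAt_comp_prodMk_right {F : Vec n × Vec n → ℝ} {F' : Vec n × Vec n →L[ℝ] ℝ}
    {a p : Vec n} (h : HasFDerivAt F F' (a, p)) :
    HasFDerivAt (fun b => F (a, b)) (F'.comp (.inr ℝ (Vec n) (Vec n))) p :=
  HasFDerivAt.comp (g := F) (f := fun b => (a, b)) p h (hasFDerivAt_prodMk_right a p)

lemma IsC2InSpace.pd_fst (hψ : IsC2InSpace T ψ) {t : ℝ} (ht : t ∈ Icc 0 T) (j : Fin n)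
    (a p : Vec n) :
    pd j (fun b => ψ t b p) a = grad ψ t (a, p) (EuclideanSpace.single j 1, 0) := by
  have h := ((hψ.contDiff t ht).differentiable (by norm_num) (a, p)).hasFDerivAt
  rw [pd, (hasFDerivAt_comp_prodMk_left h).fderiv]
  rfl

lemma IsC2InSpace.pd_snd (hψ : IsC2InSpace T ψ) {t : ℝ} (ht : t ∈ Icc 0 T) (j : Fin n)
    (a p : Vec n) :
    pd j (fun b => ψ t a b) p = grad ψ t (a, p) (0, EuclideanSpace.single j 1) := by
  have h := ((hψ.contDiff t ht).differentiable (by norm_num) (a, p)).hasFDerivAt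
  rw [pd, (hasFDerivAt_comp_prodMk_right h).fderiv]
  rfl

lemma IsC2InSpace.hasFDerivAt_grad (hψ : IsC2InSpace T ψ) {t : ℝ} (ht : t ∈ Icc 0 T)
    (z u : Vec n × Vec n) :
    HasFDerivAt (fun v => grad ψ t v u) ((hessian ψ t z).flip u) z := by
  have hd : Differentiable ℝ (fderiv ℝ (fun v : Vec n × Vec n => ψ t v.1 v.2)) :=
    ((hψ.contDiff t ht).fderiv_right (m := 1) (by norm_num)).differentiable (by norm_num)
  refine ((hd z).hasFDerivAt.clm_apply (hasFDerivAt_const u z)).congr_fderiv ?_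
  ext v <;> simp [hessian]

lemma IsC2InSpace.matA_apply (hψ : IsC2InSpace T ψ) {t : ℝ} (ht : t ∈ Icc 0 T) (i j : Fin n) :
    matA T ψ x t i j = hessian ψ t (x t, vel T x t) (EuclideanSpace.single i 1, 0)
      (EuclideanSpace.single j 1, 0) := by
  have h := hψ.hasFDerivAt_grad ht (x t, vel T x t) (EuclideanSpace.single j 1, 0)
  rw [matA, Matrix.of_apply]
  simp only [hψ.pd_fst ht]
  rw [pd, (hasFDerivAt_comp_prodMk_left h).fderiv]
  rfl

lemma IsC2InSpace.matB_apply (hψ : IsC2InSpace T ψ) {t : ℝ} (ht : t ∈ Icc 0 T) (i j : Fin n) :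
    matB T ψ x t i j = hessian ψ t (x t, vel T x t) (EuclideanSpace.single i 1, 0)
      (0, EuclideanSpace.single j 1) := by
  have h := hψ.hasFDerivAt_grad ht (x t, vel T x t) (0, EuclideanSpace.single j 1)
  rw [matB, Matrix.of_apply]
  simp only [hψ.pd_snd ht]
  rw [pd, (hasFDerivAt_comp_prodMk_left h).fderiv]
  rfl

lemma IsC2InSpace.matq_apply (hψ : IsC2InSpace T ψ) {t : ℝ} (ht : t ∈ Icc 0 T) (i j : Fin n) :
    matq T ψ x t i j = hessian ψ t (x t, vel T x t) (0, EuclideanSpace.single i 1)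
      (0, EuclideanSpace.single j 1) := by
  have h := hψ.hasFDerivAt_grad ht (x t, vel T x t) (0, EuclideanSpace.single j 1)
  rw [matq, Matrix.of_apply]
  simp only [hψ.pd_snd ht]
  rw [pd, (hasFDerivAt_comp_prodMk_right h).fderiv]
  rfl

lemma hess_apply {φ : Vec n → ℝ} {v : Vec n} (hφ : ContDiffAt ℝ 2 φ v) (i j : Fin n) :
    hess φ v i j = fderiv ℝ (fderiv ℝ φ) v (EuclideanSpace.single i 1)
      (EuclideanSpace.single j 1) := by
  have hd : DifferentiableAt ℝ (fderiv ℝ φ) v :=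
    (hφ.fderiv_right (m := 1) (by norm_num)).differentiableAt (by norm_num)
  have h := hd.hasFDerivAt.clm_apply
    (hasFDerivAt_const (EuclideanSpace.single j (1 : ℝ) : Vec n) v)
  rw [hess, Matrix.of_apply, pd]
  unfold pd
  rw [h.fderiv]
  simp

/-- The restriction of a bilinear form on `ℝⁿ × ℝⁿ` along two linear maps. -/
def pullback (D : Vec n × Vec n →L[ℝ] Vec n × Vec n →L[ℝ] ℝ) (f g : Vec n →L[ℝ] Vec n × Vec n) :
    Vec n →ₗ[ℝ] Vec n →ₗ[ℝ] ℝ :=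
  LinearMap.mk₂ ℝ (fun u v => D (f u) (g v)) (by simp) (by simp) (by simp) (by simp)

lemma IsC2InSpace.inner_matA (hψ : IsC2InSpace T ψ) {t : ℝ} (ht : t ∈ Icc 0 T) (u v : Vec n) :
    inner ℝ u (toOp (matA T ψ x t) v) = hessian ψ t (x t, vel T x t) (u, 0) (v, 0) :=
  inner_toOp_of_entries (β := pullback (hessian ψ t (x t, vel T x t))
    (.inl ℝ (Vec n) (Vec n)) (.inl ℝ (Vec n) (Vec n))) (fun i j => hψ.matA_apply ht i j) u v

lemma IsC2InSpace.inner_matB (hψ : IsC2InSpace T ψ) {t : ℝ} (ht : t ∈ Icc 0 T) (u v : Vec n) :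
    inner ℝ u (toOp (matB T ψ x t) v) = hessian ψ t (x t, vel T x t) (u, 0) (0, v) :=
  inner_toOp_of_entries (β := pullback (hessian ψ t (x t, vel T x t))
    (.inl ℝ (Vec n) (Vec n)) (.inr ℝ (Vec n) (Vec n))) (fun i j => hψ.matB_apply ht i j) u v

lemma IsC2InSpace.inner_matq (hψ : IsC2InSpace T ψ) {t : ℝ} (ht : t ∈ Icc 0 T) (u v : Vec n) :
    inner ℝ u (toOp (matq T ψ x t) v) = hessian ψ t (x t, vel T x t) (0, u) (0, v) :=
  inner_toOp_of_entries (β := pullback (hessian ψ t (x t, vel T x t))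
    (.inr ℝ (Vec n) (Vec n)) (.inr ℝ (Vec n) (Vec n))) (fun i j => hψ.matq_apply ht i j) u v

lemma inner_hess {φ : Vec n → ℝ} {v : Vec n} (hφ : ContDiffAt ℝ 2 φ v) (u w : Vec n) :
    inner ℝ u (toOp (hess φ v) w) = fderiv ℝ (fderiv ℝ φ) v u w :=
  inner_toOp_of_entries (β := LinearMap.mk₂ ℝ (fun u w => fderiv ℝ (fderiv ℝ φ) v u w)
    (by simp) (by simp) (by simp) (by simp)) (fun i j => hess_apply hφ i j) u w

lemma IsC2InSpace.hessian_eq_varForm (hψ : IsC2InSpace T ψ) {t : ℝ} (ht : t ∈ Icc 0 T)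
    (u w : Vec n) : hessian ψ t (x t, vel T x t) (u, w) (u, w) =
      varForm (toOp (matA T ψ x t)) (toOp (matB T ψ x t)) (toOp (matq T ψ x t)) u w := by
  have e : ((u, w) : Vec n × Vec n) = (u, 0) + (0, w) := by simp
  rw [varForm, hψ.inner_matA ht, hψ.inner_matB ht, hψ.inner_matq ht, e]
  simp only [map_add, add_apply]
  rw [hψ.hessian_symm ht _ (0, w) (u, 0)]
  ring

lemma IsC2InSpace.transpose_matA (hψ : IsC2InSpace T ψ) {t : ℝ} (ht : t ∈ Icc 0 T) :
    (matA T ψ x t)ᵀ = matA T ψ x t := by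
  ext i j
  rw [Matrix.transpose_apply, hψ.matA_apply ht, hψ.matA_apply ht, hψ.hessian_symm ht]

lemma IsC2InSpace.transpose_matq (hψ : IsC2InSpace T ψ) {t : ℝ} (ht : t ∈ Icc 0 T) :
    (matq T ψ x t)ᵀ = matq T ψ x t := by
  ext i j
  rw [Matrix.transpose_apply, hψ.matq_apply ht, hψ.matq_apply ht, hψ.hessian_symm ht]

lemma continuousOn_of_entries {M : ℝ → Matrix (Fin n) (Fin n) ℝ} {s : Set ℝ}
    (h : ∀ i j, ContinuousOn (fun t => M t i j) s) : ContinuousOn M s :=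
  continuousOn_pi.2 fun i => continuousOn_pi.2 fun j => h i j

lemma IsC2InSpace.continuousOn_hessian_apply (hT : 0 < T) (hψ : IsC2InSpace T ψ)
    (hx : IsC1Path T x) (u w : Vec n × Vec n) :
    ContinuousOn (fun t => hessian ψ t (x t, vel T x t) u w) (Icc 0 T) :=
  ((hψ.continuousOn_hessian (hx.continuousOn.prodMk (hx.continuousOn_vel hT))).clm_apply
    continuousOn_const).clm_apply continuousOn_const

lemma IsC2InSpace.continuousOn_matA (hT : 0 < T) (hψ : IsC2InSpace T ψ) (hx : IsC1Path T x) :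
    ContinuousOn (matA T ψ x) (Icc 0 T) :=
  continuousOn_of_entries fun i j =>
    (hψ.continuousOn_hessian_apply hT hx _ _).congr fun _ ht => hψ.matA_apply ht i j

lemma IsC2InSpace.continuousOn_matB (hT : 0 < T) (hψ : IsC2InSpace T ψ) (hx : IsC1Path T x) :
    ContinuousOn (matB T ψ x) (Icc 0 T) :=
  continuousOn_of_entries fun i j =>
    (hψ.continuousOn_hessian_apply hT hx _ _).congr fun _ ht => hψ.matB_apply ht i j

lemma IsC2InSpace.continuousOn_matq (hT : 0 < T) (hψ : IsC2InSpace T ψ) (hx : IsC1Path T x) :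
    ContinuousOn (matq T ψ x) (Icc 0 T) :=
  continuousOn_of_entries fun i j =>
    (hψ.continuousOn_hessian_apply hT hx _ _).congr fun _ ht => hψ.matq_apply ht i j

lemma continuousOn_matrix_inv {M : ℝ → Matrix (Fin n) (Fin n) ℝ} {s : Set ℝ}
    (hM : ContinuousOn M s) (hu : ∀ t ∈ s, IsUnit (M t)) :
    ContinuousOn (fun t => (M t)⁻¹) s := fun t ht => by
  have hdet : (M t).det ≠ 0 := ((Matrix.isUnit_iff_isUnit_det _).1 (hu t ht)).ne_zero
  have hinv : ContinuousAt Ring.inverse (M t).det := by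
    rw [Ring.inverse_eq_inv']
    exact continuousAt_inv₀ hdet
  exact (continuousAt_matrix_inv (M t) hinv).comp_continuousWithinAt (hM t ht)

/-- A kernel vector would annihilate the quadratic form. -/
lemma isUnit_of_inner_pos {M : Matrix (Fin n) (Fin n) ℝ}
    (h : ∀ v : Vec n, v ≠ 0 → 0 < inner ℝ v (toOp M v)) : IsUnit M := by
  rw [← Matrix.mulVec_injective_iff_isUnit, ← Matrix.coe_mulVecLin, injective_iff_map_eq_zero]
  intro v hv
  by_contra hv0
  have h1 := h (WithLp.toLp 2 v) (by simpa using hv0)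
  rw [Matrix.inner_toEuclideanCLM] at h1
  rw [Matrix.mulVecLin_apply] at hv
  simp [hv] at h1

end Matrices

/-! ### The Riccati equation for matrices and the theorem -/

section Main

variable {n : ℕ} {T : ℝ} {A B q θ : ℝ → Matrix (Fin n) (Fin n) ℝ}

lemma isRiccatiSolution_iff :
    IsRiccatiSolution T A B q θ ↔ (∀ t ∈ Icc 0 T, HasDerivWithinAt (fun t => toOp (θ t))
      (-toOp (A t) + riccatiQuad (toOp (B t)) (toOp (q t)⁻¹) (toOp (θ t))) (Icc 0 T) t) ∧
      toOp (θ T) = 0 := by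
  have e : ∀ t, -toOp (A t) + riccatiQuad (toOp (B t)) (toOp (q t)⁻¹) (toOp (θ t)) =
      toOp (-A t + (B t + θ t) * (q t)⁻¹ * ((B t)ᵀ + θ t)) := fun t => by
    simp only [riccatiQuad, star_toOp, toOp, map_add, map_neg, map_mul]
  simp only [e, hasDerivWithinAt_toOp_iff]
  refine and_congr (forall₂_congr fun t _ => ⟨?_, fun h => ⟨_, h, add_neg_cancel_left _ _⟩⟩) ?_
  · rintro ⟨θ', h, h'⟩
    rwa [← h', neg_add_cancel_left]
  · exact (map_eq_zero_iff _ (Matrix.toEuclideanCLM (n := Fin n) (𝕜 := ℝ)).injective).symm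

end Main

end LeastAction

end

open LeastAction in
theorem theorem3 {n s : ℕ} (T : ℝ) (hT : 0 < T)
    (σ : ℝ → State n s → StateMat n s) (μ : ℝ → State n s → State n s)
    (hσ : ∀ t ∈ Icc 0 T, ∀ z, IsUnit (σ t z))
    (y : ℝ → Vec s) (hy : IsC1Path T y)
    (hψ : IsC2InSpace T (psi (n := n) T σ μ y))
    (φ : Vec n → ℝ) (xs : ℝ → Vec n) (hφ : ContDiffAt ℝ 2 φ (xs 0))
    (hmin : IsLocalMinimizer T (fun x => -Lam T σ μ y φ x) xs)
    (A B q : ℝ → Matrix (Fin n) (Fin n) ℝ)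
    (hA : A = matA T (psi T σ μ y) xs)
    (hB : B = matB T (psi T σ μ y) xs)
    (hq : q = matq T (psi T σ μ y) xs) :
    (∀ t ∈ Icc 0 T, IsUnit (q t)) ∧
    (∃ θ, IsRiccatiSolution T A B q θ) ∧
    (∀ θ₁ θ₂, IsRiccatiSolution T A B q θ₁ → IsRiccatiSolution T A B q θ₂ →
      EqOn θ₁ θ₂ (Icc 0 T)) ∧
    ∀ θ, IsRiccatiSolution T A B q θ →
      (∀ t ∈ Icc 0 T, (matK B q θ t)ᵀ * q t * matK B q θ t =
        (B t + θ t) * (q t)⁻¹ * ((B t)ᵀ + θ t)) ∧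
      ∀ ε > 0, ∃ δ > 0, ∀ ξ : ℝ → Vec n, IsC1Path T ξ → energy T ξ < δ →
        |(-Lam T σ μ y φ (xs + ξ) + Lam T σ μ y φ xs) -
          Q₀ T (hess φ (xs 0)) q θ (matK B q θ) ξ| ≤ ε * energy T ξ := by
  subst hA hB hq
  set ψ := psi (n := n) T σ μ y with hψdef
  set A := matA T ψ xs with hA
  set B := matB T ψ xs with hB
  set q := matq T ψ xs with hq
  have hx : IsC1Path T xs := hmin.1
  have hact : ∀ x, -Lam T σ μ y φ x = action T ψ φ x := fun x => by
    rw [Lam, action]; ring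
  have hmin' : IsLocalMinimizer T (action T ψ φ) xs := by
    simpa only [hact] using hmin
  have hvar := fun {ξ : ℝ → Vec n} (hξ : IsC1Path T ξ) =>
    hmin'.variation hT hψ quadraticInVelocity_psi hφ hξ
  have hqpos : ∀ t ∈ Icc 0 T, ∀ v : Vec n, v ≠ 0 → 0 < inner ℝ v (toOp (q t) v) :=
    fun t ht v hv => by
      rw [hq, hψ.inner_matq ht]
      exact hessian_psi_velocity_pos hψ ht (hσ t ht) _ hv
  have hqu : ∀ t ∈ Icc 0 T, IsUnit (q t) := fun t ht => isUnit_of_inner_pos (hqpos t ht)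
  have hqinv : ∀ t ∈ Icc 0 T, q t * (q t)⁻¹ = 1 := fun t ht =>
    Matrix.mul_nonsing_inv _ ((Matrix.isUnit_iff_isUnit_det _).1 (hqu t ht))
  have hAc : ContinuousOn (fun t => toOp (A t)) (Icc 0 T) :=
    continuous_toOp.comp_continuousOn (hψ.continuousOn_matA hT hx)
  have hBc : ContinuousOn (fun t => toOp (B t)) (Icc 0 T) :=
    continuous_toOp.comp_continuousOn (hψ.continuousOn_matB hT hx)
  have hqc : ContinuousOn (fun t => toOp (q t)) (Icc 0 T) :=
    continuous_toOp.comp_continuousOn (hψ.continuousOn_matq hT hx)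
  have hrc : ContinuousOn (fun t => toOp (q t)⁻¹) (Icc 0 T) :=
    continuous_toOp.comp_continuousOn (continuousOn_matrix_inv (hψ.continuousOn_matq hT hx) hqu)
  have hqT : ∀ t ∈ Icc 0 T, (q t)ᵀ = q t := fun t ht => hψ.transpose_matq ht
  have hAs : ∀ t ∈ Icc 0 T, star (toOp (A t)) = toOp (A t) := fun t ht => by
    rw [star_toOp, hA, hψ.transpose_matA ht]
  have hqs : ∀ t ∈ Icc 0 T, star (toOp (q t)) = toOp (q t) := fun t ht => by
    rw [star_toOp, hqT t ht]
  have hrs : ∀ t ∈ Icc 0 T, star (toOp (q t)⁻¹) = toOp (q t)⁻¹ := fun t ht => by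
    rw [star_toOp, Matrix.transpose_nonsing_inv, hqT t ht]
  have hqr : ∀ t ∈ Icc 0 T, toOp (q t) * toOp (q t)⁻¹ = 1 := fun t ht => by
    rw [toOp, toOp, ← map_mul, hqinv t ht, map_one]
  have hsec : ∀ {ξ w : ℝ → Vec n}, (∀ t ∈ Icc 0 T, vel T ξ t = w t) →
      secondVar T ψ φ xs ξ = inner ℝ (ξ 0) (toOp (hess φ (xs 0)) (ξ 0)) +
        ∫ t in (0 : ℝ)..T, varForm (toOp (A t)) (toOp (B t)) (toOp (q t)) (ξ t) (w t) := by
    intro ξ w hw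
    rw [secondVar, inner_hess hφ]
    congr 1
    refine intervalIntegral.integral_congr fun t ht => ?_
    rw [uIcc_of_le hT.le] at ht
    simp only [← hw t ht]
    exact hψ.hessian_eq_varForm ht _ _
  refine ⟨hqu, ?_, fun θ₁ θ₂ h₁ h₂ => ?_, fun θ hθ => ?_⟩
  · obtain ⟨Θ, hΘ, hΘT⟩ := exists_riccati_solution hT.le (H := toOp (hess φ (xs 0))) hAc hBc hqc hrc
      hAs hqs hrs (fun t ht v => by
        rcases eq_or_ne v 0 with rfl | hv
        · simp
        -- The admissible pairs in the Riccati theorem are exactly C¹ paths with their velocities,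
        -- where the second variation is known to be nonnegative.
        · exact (hqpos t ht v hv).le) hqr (fun x w hxw hw => by
        have hx1 := isC1Path_of_hasDerivWithinAt hT hxw hw
        rw [← hsec fun t ht => vel_eq_of_hasDerivWithinAt hT ht (hxw t ht)]
        exact (hvar hx1).2)
    have e : ∀ S : Vec n →L[ℝ] Vec n,
        toOp ((Matrix.toEuclideanCLM (n := Fin n) (𝕜 := ℝ)).symm S) = S := fun S =>
      (Matrix.toEuclideanCLM (n := Fin n) (𝕜 := ℝ)).apply_symm_apply S
    refine ⟨fun t => (Matrix.toEuclideanCLM (n := Fin n) (𝕜 := ℝ)).symm (Θ t), ?_⟩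
    rw [isRiccatiSolution_iff]
    simp only [e]
    exact ⟨hΘ, hΘT⟩
  · rw [isRiccatiSolution_iff] at h₁ h₂
    have := riccati_unique hBc hrc h₁.1 h₂.1 (h₁.2.trans h₂.2.symm)
    exact fun t ht => (Matrix.toEuclideanCLM (n := Fin n) (𝕜 := ℝ)).injective (this ht)
  · rw [isRiccatiSolution_iff] at hθ
    have hΘs := riccati_star_eq hBc hrc hAs hrs hθ.1 hθ.2
    have hθT : ∀ t ∈ Icc 0 T, (θ t)ᵀ = θ t := fun t ht => by
      have := hΘs t ht
      rw [star_toOp] at this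
      exact (Matrix.toEuclideanCLM (n := Fin n) (𝕜 := ℝ)).injective this
    refine ⟨fun t ht => ?_, fun ε hε => ?_⟩
    · rw [matK, Matrix.transpose_mul, Matrix.transpose_add, Matrix.transpose_transpose,
        hθT t ht, Matrix.transpose_nonsing_inv, hqT t ht, Matrix.mul_assoc,
        ← Matrix.mul_assoc (q t), hqinv t ht, Matrix.one_mul]
    · obtain ⟨δ, hδ, hexp⟩ := exists_action_expansion hT hψ quadraticInVelocity_psi hx hφ hε
      refine ⟨δ, hδ, fun ξ hξ hE => ?_⟩
      have h1 := hexp ξ hξ hE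
      rw [(hvar hξ).1, sub_zero] at h1
      -- Completing the square with `g = 1`, that is, without cutoff: the deficit term disappears.
      have hQ : 1 / 2 * secondVar T ψ φ xs ξ = Q₀ T (hess φ (xs 0)) q θ (matK B q θ) ξ := by
        rw [hsec fun t _ => rfl, integral_varForm_eq hT.le hAc hBc hqc hrc hqs hqr
          (continuousOn_const (c := (1 : ℝ))) (by simpa only [one_smul] using hθ.1) hΘs hθ.2
          (fun t ht => hξ.hasDerivWithinAt ht) (hξ.continuousOn_vel hT), Q₀,
          intervalIntegral.integral_const_mul, ← add_assoc, ← inner_add_right, ← add_apply,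
          toOp, toOp, ← map_add, Matrix.inner_toEuclideanCLM, mul_add]
        congr 2
        refine intervalIntegral.integral_congr fun t ht => ?_
        simp only [sub_self, zero_mul, sub_zero]
        rw [star_toOp, toOp, toOp, toOp, toOp, ← map_add, ← map_mul, Matrix.inner_toEuclideanCLM]
        rfl
      rw [← hQ, ← sub_neg_eq_add, hact, hact]
      exact h1
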